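/- Let $d\in\{2,3\}$ and let $\Omega\subset\mathbb R^d$ be a bounded, connected, nonempty open set with $\Omega=\operatorname{int}\overline\Omega$ (for instance a connected polygonal or polyhedral domain with Lipschitz boundary) that has a conforming triangulation $\mathcal T_h$: a finite set of closed non-degenerate $d$-simplices whose union is $\overline\Omega$, any two distinct ones meeting exactly in the simplex (possibly empty) spanned by their common vertices. For $\kappa\in\mathcal T_h$ let $\mathbb P_1(\kappa)$ be the polynomials of total degree at most $1$ restricted to $\kappa$, let $b_\kappa$ be the product of the $d+1$ barycentric coordinates of $\kappa$, and put $\mathcal P(\kappa)=\mathbb P_1(\kappa)\oplus\operatorname{Vect}\{b_\kappa\}$. Define the mini-element spaces $$X_{0h}=\{v\in\mathcal C^0(\overline\Omega)^d:\ v|_\kappa\in\mathcal P(\kappa)^d\ \ \forall\kappa\in\mathcal T_h\}\cap H^1_0(\Omega)^d,$$ $$M_h=\{q\in\mathcal C^0(\overline\Omega):\ q|_\kappa\in\mathbb P_1(\kappa)\ \ \forall\kappa\in\mathcal T_h\},\qquad M_{0h}=M_h\cap L^2_0(\Omega),$$ where $L^2_0(\Omega)$ is the space of functions in $L^2(\Omega)$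 with zero mean. Let $Re>0$, $\varepsilon_0>0$, let $\varepsilon_h\in M_h$ satisfy $\varepsilon_0\le\varepsilon_h\le1$ in $\Omega$, and let $\alpha,\beta$ be real functions that are positive on $[\varepsilon_0,1]$ and differentiable on $]\varepsilon_0,1[$ with positive and bounded derivatives there. Let $f\in L^2(\Omega)^d$ and $G\in H^1(\Omega)^d$. With $(\cdot,\cdot)$ the $L^2(\Omega)$ scalar product and $|\cdot|$ the Euclidean norm, put $$a_h(u,v)=\tfrac1{Re}(\varepsilon_h\nabla u,\nabla v)+(\alpha(\varepsilon_h)u,v),\qquad b_h(u,q)=(\operatorname{div}(\varepsilon_hu),q),\qquad \ell_h(v)=(\varepsilon_hf,v),$$ $$c_h(u,v,w)=(\varepsilon_h(u\cdot\nabla)v,w)+\tfrac12(\operatorname{div}(\varepsilon_hu)\,v,w)+(\beta(\varepsilon_h)|u|\,v,w).$$ Then for every given iterate $w_h^i\in X_{0h}$ there is exactly one pair $(w_h^{i+1},p_h^{i+1})\in X_{0h}\times M_{0h}$ such that $$a_h(w_h^{i+1},v_h)+c_h(w_h^i+G,w_h^{i+1},v_h)-b_h(v_h,p_h^{i+1})=\ell_h(v_h)-a_h(G,v_h)-c_h(w_h^i+G,G,v_h)\quad\forall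 v_h\in X_{0h},$$ $$b_h(w_h^{i+1},q_h)=0\quad\forall q_h\in M_{0h}.$$ -/

import Mathlib

noncomputable section

namespace DBF

open MeasureTheory Filter Topology
open scoped ContDiff

/-- Euclidean space `ℝ^d` with its Euclidean norm. -/
abbrev E (d : ℕ) : Type := EuclideanSpace ℝ (Fin d)

/-! ### Sobolev spaces through weak derivatives -/

/-- Test functions: smooth functions with compact support contained in `Ω`. -/
def IsTest {d : ℕ} (Ω : Set (E d)) (φ : E d → ℝ) : Prop :=
  ContDiff ℝ ∞ φ ∧ HasCompactSupport φ ∧ tsupport φ ⊆ Ω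

/-- Classical partial derivative `∂φ/∂x_i`. -/
def classicalPartial {d : ℕ} (i : Fin d) (φ : E d → ℝ) (x : E d) : ℝ :=
  fderiv ℝ φ x (EuclideanSpace.single i 1)

/-- `g` is the weak (distributional) partial derivative `∂u/∂x_i` of `u` in `Ω`;
both functions are locally integrable in `Ω`. -/
def HasWeakPartial {d : ℕ} (Ω : Set (E d)) (i : Fin d) (u g : E d → ℝ) : Prop :=
  LocallyIntegrableOn u Ω volume ∧ LocallyIntegrableOn g Ω volume ∧
    ∀ φ : E d → ℝ, IsTest Ω φ →
      ∫ x in Ω, u x * classicalPartial i φ x = - ∫ x in Ω, g x * φ x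

open Classical in
/-- The weak partial derivative `∂u/∂x_i` in `Ω` (unique almost everywhere in the open set `Ω`;
the value is `0` if there is none, which never occurs for the functions in `H¹(Ω)` below). -/
def weakPartial {d : ℕ} (Ω : Set (E d)) (i : Fin d) (u : E d → ℝ) : E d → ℝ :=
  if h : ∃ g, HasWeakPartial Ω i u g then h.choose else 0

/-- `u ∈ H¹(Ω)`: `u` and its weak first derivatives belong to `L²(Ω)`. -/
def MemH1 {d : ℕ} (Ω : Set (E d)) (u : E d → ℝ) : Prop :=
  MemLp u 2 (volume.restrict Ω) ∧
    ∀ i : Fin d, ∃ g, HasWeakPartial Ω i u g ∧ MemLp g 2 (volume.restrict Ω)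

/-- `u ∈ H¹₀(Ω)`: `u` is the limit in `H¹(Ω)` of a sequence of test functions. -/
def MemH10 {d : ℕ} (Ω : Set (E d)) (u : E d → ℝ) : Prop :=
  MemH1 Ω u ∧ ∃ φ : ℕ → E d → ℝ, (∀ n, IsTest Ω (φ n)) ∧
    Tendsto (fun n => eLpNorm (fun x => u x - φ n x) 2 (volume.restrict Ω)) atTop (𝓝 0) ∧
    ∀ i : Fin d, Tendsto
      (fun n => eLpNorm (fun x => weakPartial Ω i u x - classicalPartial i (φ n) x) 2
        (volume.restrict Ω)) atTop (𝓝 0)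

/-- `q ∈ L²₀(Ω)`: square integrable functions with zero mean. -/
def MemL20 {d : ℕ} (Ω : Set (E d)) (q : E d → ℝ) : Prop :=
  MemLp q 2 (volume.restrict Ω) ∧ ∫ x in Ω, q x = 0

/-- Vector-valued version of `H¹(Ω)`. -/
def MemH1Vec {d : ℕ} (Ω : Set (E d)) (u : E d → E d) : Prop :=
  ∀ j : Fin d, MemH1 Ω (fun x => u x j)

/-- Vector-valued version of `H¹₀(Ω)`. -/
def MemH10Vec {d : ℕ} (Ω : Set (E d)) (u : E d → E d) : Prop :=
  ∀ j : Fin d, MemH10 Ω (fun x => u x j)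

/-- Weak divergence. -/
def weakDiv {d : ℕ} (Ω : Set (E d)) (u : E d → E d) (x : E d) : ℝ :=
  ∑ i : Fin d, weakPartial Ω i (fun y => u y i) x

/-! ### Triangulations and the mini-element -/

/-- A non-degenerate `d`-simplex (triangle, tetrahedron), given by its `d + 1` affinely
independent vertices. -/
abbrev Elt (d : ℕ) : Type := AffineBasis (Fin (d + 1)) ℝ (E d)

/-- The set of vertices of a simplex. -/
def Elt.vertices {d : ℕ} (κ : Elt d) : Set (E d) := Set.range fun i : Fin (d + 1) => κ i

/-- The closed simplex. -/
def Elt.carrier {d : ℕ} (κ : Elt d) : Set (E d) := convexHull ℝ κ.vertices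

/-- The bubble function `b_κ`, the product of the barycentric coordinates of `κ`. -/
def Elt.bubble {d : ℕ} (κ : Elt d) (x : E d) : ℝ := ∏ i : Fin (d + 1), κ.coord i x

/-- A conforming triangulation of `Ω`: a finite set of non-degenerate closed simplices whose union
is the closure of `Ω`, two distinct ones meeting exactly in the simplex spanned by their common
vertices (nothing, a common vertex, an entire common edge or an entire common face). -/
structure Triangulation {d : ℕ} (Ω : Set (E d)) where
  elts : Finset (Elt d)
  injOn : Set.InjOn (fun κ : Elt d => κ.vertices) elts
  inter : ∀ κ ∈ elts, ∀ κ' ∈ elts, κ ≠ κ' →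
    κ.carrier ∩ κ'.carrier = convexHull ℝ (κ.vertices ∩ κ'.vertices)
  union : ⋃ κ ∈ elts, κ.carrier = closure Ω

/-- Extension by zero to `ℝ^d` of a function on the closure of `Ω`. -/
def ext {d : ℕ} {Ω : Set (E d)} {F : Type} [Zero F] (v : closure Ω → F) : E d → F :=
  Function.extend Subtype.val v 0

/-- `g` coincides on the set `K` with a polynomial of total degree at most one. -/
def IsP1On {d : ℕ} (K : Set (E d)) (g : E d → ℝ) : Prop :=
  ∃ p : MvPolynomial (Fin d) ℝ, p.totalDegree ≤ 1 ∧
    ∀ x ∈ K, g x = MvPolynomial.eval (fun i => x i) p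

/-- `g` belongs on `κ` to the local space `P₁(κ) ⊕ Vect {b_κ}` of the mini-element. -/
def IsMiniOn {d : ℕ} (κ : Elt d) (g : E d → ℝ) : Prop :=
  ∃ p : MvPolynomial (Fin d) ℝ, p.totalDegree ≤ 1 ∧ ∃ c : ℝ,
    ∀ x ∈ κ.carrier, g x = MvPolynomial.eval (fun i => x i) p + c * κ.bubble x

/-- The space `X_h` of continuous vector fields on the closure of `Ω`, each component of which
belongs on every element to the local space of the mini-element. -/
def Xh {d : ℕ} {Ω : Set (E d)} (T : Triangulation Ω) : Set C(closure Ω, E d) :=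
  {v | ∀ κ ∈ T.elts, ∀ j : Fin d, IsMiniOn κ (fun x => ext v x j)}

/-- `X_{0h} = X_h ∩ H¹₀(Ω)^d`. -/
def X0h {d : ℕ} {Ω : Set (E d)} (T : Triangulation Ω) : Set C(closure Ω, E d) :=
  {v | v ∈ Xh T ∧ MemH10Vec Ω (ext v)}

/-- The space `M_h` of continuous functions on the closure of `Ω` that are affine on every
element. -/
def Mh {d : ℕ} {Ω : Set (E d)} (T : Triangulation Ω) : Set C(closure Ω, ℝ) :=
  {q | ∀ κ ∈ T.elts, IsP1On κ.carrier (ext q)}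

/-- `M_{0h} = M_h ∩ L²₀(Ω)`. -/
def M0h {d : ℕ} {Ω : Set (E d)} (T : Triangulation Ω) : Set C(closure Ω, ℝ) :=
  {q | q ∈ Mh T ∧ MemL20 Ω (ext q)}

/-! ### The data and the forms -/

/-- The assumptions on the Darcy and the Forchheimer coefficient, as functions of the porosity:
positive on `[ε₀, 1]`, differentiable in `]ε₀, 1[` with positive and bounded derivative. -/
structure AdmissibleCoeff (ε₀ : ℝ) (α : ℝ → ℝ) : Prop where
  pos : ∀ t ∈ Set.Icc ε₀ 1, 0 < α t
  diff : ∀ t ∈ Set.Ioo ε₀ 1, DifferentiableAt ℝ α t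
  deriv_pos : ∀ t ∈ Set.Ioo ε₀ 1, 0 < deriv α t
  deriv_bdd : ∃ K : ℝ, ∀ t ∈ Set.Ioo ε₀ 1, deriv α t ≤ K

/-- `a_h(u,v) = Re⁻¹ (ε_h ∇u, ∇v) + (α(ε_h) u, v)`. -/
def aForm {d : ℕ} (Ω : Set (E d)) (Re : ℝ) (α : ℝ → ℝ) (ε : E d → ℝ) (u v : E d → E d) : ℝ :=
  1 / Re * (∫ x in Ω, ε x * ∑ i : Fin d, ∑ j : Fin d,
      weakPartial Ω i (fun y => u y j) x * weakPartial Ω i (fun y => v y j) x)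
    + ∫ x in Ω, α (ε x) * inner ℝ (u x) (v x)

/-- `c_h(u,v,w) = (ε_h (u·∇)v, w) + 1/2 (div(ε_h u) v, w) + (β(ε_h) |u| v, w)`. -/
def cForm {d : ℕ} (Ω : Set (E d)) (β : ℝ → ℝ) (ε : E d → ℝ) (u v w : E d → E d) : ℝ :=
  (∫ x in Ω, ε x * ∑ j : Fin d,
      (∑ i : Fin d, u x i * weakPartial Ω i (fun y => v y j) x) * w x j)
    + 1 / 2 * (∫ x in Ω, weakDiv Ω (fun y => ε y • u y) x * inner ℝ (v x) (w x))
    + ∫ x in Ω, β (ε x) * ‖u x‖ * inner ℝ (v x) (w x)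

/-- `b_h(u,q) = (div(ε_h u), q)`. -/
def bForm {d : ℕ} (Ω : Set (E d)) (ε : E d → ℝ) (u : E d → E d) (q : E d → ℝ) : ℝ :=
  ∫ x in Ω, weakDiv Ω (fun y => ε y • u y) x * q x

/-- `ℓ_h(v) = (ε_h f, v)`. -/
def lForm {d : ℕ} (Ω : Set (E d)) (ε : E d → ℝ) (f v : E d → E d) : ℝ :=
  ∫ x in Ω, inner ℝ (ε x • f x) (v x)

/-- `(w', p')` solves, for the given iterate `w`, the linearized discrete problem defining the
next iterate. -/
def IsNextIterate {d : ℕ} {Ω : Set (E d)} (T : Triangulation Ω) (Re : ℝ) (α β : ℝ → ℝ)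
    (εh : C(closure Ω, ℝ)) (f G : E d → E d) (w : C(closure Ω, E d))
    (w' : C(closure Ω, E d)) (p' : C(closure Ω, ℝ)) : Prop :=
  (∀ v ∈ X0h T,
    aForm Ω Re α (ext εh) (ext w') (ext v)
      + cForm Ω β (ext εh) (fun x => ext w x + G x) (ext w') (ext v)
      - bForm Ω (ext εh) (ext v) (ext p')
    = lForm Ω (ext εh) f (ext v)
      - aForm Ω Re α (ext εh) G (ext v)
      - cForm Ω β (ext εh) (fun x => ext w x + G x) G (ext v)) ∧
  ∀ q ∈ M0h T, bForm Ω (ext εh) (ext w') (ext q) = 0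

end DBF

end

/-!
The two equations form a linear system for `(w_h^{i+1}, p_h^{i+1})` in which the number of unknowns
equals the number of equations, so uniqueness suffices. Let `(w, p)` solve the homogeneous system.

* Take `v_h = w` and use the second equation: the pressure term vanishes. The term
  `½ (div (ε_h u) v, w)` makes the convection skew-symmetric, because
  `div (ε_h u) |w|² + 2 ε_h (u · ∇) w · w` is the divergence of `ε_h |w|² u`. What remains of the
  energy is a sum of non-negative integrals including `(α(ε_h) w, w)`, hence `w = 0`.
* Then `(div (ε_h v), p) = 0` for all `v`. For `v = b_κ e_j` an integration by parts gives
  `∫ ε_h b_κ ∂_j p = 0`. Since `∂_j p` is constant on `κ` and `ε_h b_κ > 0` inside `κ`, the pressure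
  is constant on every simplex; being continuous on the connected set `Ω` with zero mean, it is `0`.

The integrations by parts rest on one fact: a weak derivative may be tested against compactly
supported Lipschitz functions, by mollification. Thus Lipschitz functions act as multipliers on
`H¹(Ω)`, and discrete functions are Lipschitz on balls because they are so on each of finitely many
closed pieces.
-/

noncomputable section

namespace DBF

open MeasureTheory Filter Topology
open scoped ContDiff

variable {d : ℕ} {Ω : Set (E d)}

/-! ### Pointwise Lipschitz bounds -/

theorem continuousWithinAt_of_eventually_dist_le {X Y : Type*} [PseudoMetricSpace X]
    [PseudoMetricSpace Y] {s : Set X} {f : X → Y} {K : ℝ} {x : X}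
    (h : ∀ᶠ y in 𝓝[s] x, dist (f y) (f x) ≤ K * dist y x) : ContinuousWithinAt f s x := by
  have hlim : Tendsto (fun y => K * dist y x) (𝓝[s] x) (𝓝 0) := by
    have hc : Continuous fun y => K * dist y x := by fun_prop
    simpa using (hc.tendsto x).mono_left nhdsWithin_le_nhds
  exact tendsto_iff_dist_tendsto_zero.2
    (squeeze_zero' (Eventually.of_forall fun _ => dist_nonneg) h hlim)

theorem lipschitzOnWith_of_eventually_dist_le {V Y : Type*} [NormedAddCommGroup V]
    [NormedSpace ℝ V] [PseudoMetricSpace Y] {s : Set V} (hs : Convex ℝ s) {f : V → Y} {K : NNReal}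
    (h : ∀ x ∈ s, ∀ᶠ y in 𝓝[s] x, dist (f y) (f x) ≤ K * dist y x) : LipschitzOnWith K f s := by
  refine LipschitzOnWith.of_dist_le_mul fun y hy x hx => ?_
  let L : ℝ → V := AffineMap.lineMap x y
  have hL : Continuous L := AffineMap.lineMap_continuous
  have hLs : Set.MapsTo L (Set.Icc 0 1) s := fun t ht => hs.lineMap_mem hx hy ht
  have hf : ContinuousOn f s := fun z hz => continuousWithinAt_of_eventually_dist_le (h z hz)
  have hcont : ContinuousOn (fun t => dist (f (L t)) (f x)) (Set.Icc 0 1) :=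
    continuous_dist.comp_continuousOn ((hf.comp hL.continuousOn hLs).prodMk continuousOn_const)
  have hslope : ∀ t ∈ Set.Ico (0 : ℝ) 1, ∀ᶠ r in 𝓝[>] t,
      slope (fun t => dist (f (L t)) (f x)) t r ≤ K * dist y x := by
    intro t ht
    have hLt : Tendsto L (𝓝[>] t) (𝓝[s] (L t)) := tendsto_nhdsWithin_iff.2
      ⟨(hL.tendsto t).mono_left nhdsWithin_le_nhds,
        mem_of_superset (Ioc_mem_nhdsGT ht.2) fun r hr => hLs ⟨ht.1.trans hr.1.le, hr.2⟩⟩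
    filter_upwards [hLt.eventually (h _ (hLs ⟨ht.1, ht.2.le⟩)), self_mem_nhdsWithin] with r hr htr
    have hrt : 0 < r - t := sub_pos.2 htr
    have hdist : dist (L r) (L t) = (r - t) * dist y x := by
      simp only [L, dist_lineMap_lineMap, Real.dist_eq, abs_of_pos hrt, dist_comm x y]
    have htri := dist_triangle (f (L r)) (f (L t)) (f x)
    rw [slope_def_field, div_le_iff₀ hrt]
    rw [hdist] at hr
    linarith
  have hend := image_le_of_liminf_slope_right_le_deriv_boundary (B := fun t => K * dist y x * t)
    (B' := fun _ => K * dist y x) hcont (by simp [L]) (by fun_prop)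
    (fun t _ => by simpa using ((hasDerivAt_id t).const_mul (K * dist y x)).hasDerivWithinAt)
    (fun t ht r hr => ((hslope t ht).mono fun _ hz => hz.trans_lt hr).frequently)
    (Set.right_mem_Icc.2 zero_le_one)
  simpa [L] using hend

theorem eventually_dist_le_of_finite_closed_cover {X Y ι : Type*} [PseudoMetricSpace X]
    [PseudoMetricSpace Y] {I : Finset ι} {A : ι → Set X} (hA : ∀ k ∈ I, IsClosed (A k))
    {f : X → Y} {K : NNReal} (hf : ∀ k ∈ I, LipschitzOnWith K f (A k)) (x : X) :
    ∀ᶠ y in 𝓝[⋃ k ∈ I, A k] x, dist (f y) (f x) ≤ K * dist y x := by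
  have hmem : ∀ᶠ y in 𝓝 x, ∀ k ∈ I, y ∈ A k → x ∈ A k := by
    refine (Finset.eventually_all I).2 fun k hk => ?_
    by_cases hx : x ∈ A k
    · exact Eventually.of_forall fun _ _ => hx
    · filter_upwards [(hA k hk).isOpen_compl.mem_nhds hx] with y hy hy' using absurd hy' hy
  filter_upwards [nhdsWithin_le_nhds hmem, self_mem_nhdsWithin] with y hy hyU
  obtain ⟨k, hk, hyk⟩ := Set.mem_iUnion₂.1 hyU
  exact (hf k hk).dist_le_mul y hyk x (hy k hk hyk)

/-! ### Weak derivatives tested against Lipschitz functions -/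

theorem measurable_classicalPartial (i : Fin d) (φ : E d → ℝ) :
    Measurable (classicalPartial i φ) :=
  measurable_fderiv_apply_const ℝ φ _

theorem abs_classicalPartial_le {i : Fin d} {ψ : E d → ℝ} {K : NNReal} {x : E d}
    (h : ∀ᶠ y in 𝓝 x, dist (ψ y) (ψ x) ≤ K * dist y x) : |classicalPartial i ψ x| ≤ K := by
  have hK : ‖fderiv ℝ ψ x‖ ≤ K :=
    norm_fderiv_le_of_lip' ℝ K.coe_nonneg (by simpa only [dist_eq_norm] using h)
  simpa [classicalPartial] using (fderiv ℝ ψ x).le_of_opNorm_le hK (EuclideanSpace.single i 1)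

section Mollification

open scoped Convolution Pointwise
open ContinuousLinearMap (lsmul)

variable (η : ContDiffBump (0 : E d))

theorem tsupport_normed_convolution_subset (ψ : E d → ℝ) :
    tsupport (η.normed volume ⋆[lsmul ℝ ℝ, volume] ψ)
      ⊆ Metric.cthickening η.rOut (tsupport ψ) := by
  refine closure_minimal ?_ Metric.isClosed_cthickening
  calc Function.support (η.normed volume ⋆[lsmul ℝ ℝ, volume] ψ)
      ⊆ Function.support ψ + Metric.ball 0 η.rOut := by
        rw [add_comm, ← η.support_normed_eq (μ := volume)]
        exact support_convolution_subset _
    _ = Metric.thickening η.rOut (Function.support ψ) := add_ball_zero _ _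
    _ ⊆ Metric.thickening η.rOut (tsupport ψ) :=
        Metric.thickening_subset_of_subset _ (subset_tsupport ψ)
    _ ⊆ Metric.cthickening η.rOut (tsupport ψ) := Metric.thickening_subset_cthickening _ _

theorem isTest_normed_convolution {ψ : E d → ℝ} (hψ : Continuous ψ) (hc : HasCompactSupport ψ)
    (hΩ : Metric.cthickening η.rOut (tsupport ψ) ⊆ Ω) :
    IsTest Ω (η.normed volume ⋆[lsmul ℝ ℝ, volume] ψ) :=
  ⟨η.hasCompactSupport_normed.contDiff_convolution_left _ η.contDiff_normed hψ.locallyIntegrable,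
    hc.isCompact.cthickening.of_isClosed_subset (isClosed_tsupport _)
      (tsupport_normed_convolution_subset η ψ),
    (tsupport_normed_convolution_subset η ψ).trans hΩ⟩

theorem abs_normed_convolution_le {g : E d → ℝ} (hg : Measurable g) {C : ℝ} (hC : 0 ≤ C)
    (hgC : ∀ x, |g x| ≤ C) (x : E d) : |(η.normed volume ⋆[lsmul ℝ ℝ, volume] g) x| ≤ C := by
  simpa using dist_convolution_le (z₀ := 0) hC (η.support_normed_eq (μ := volume)).subset
    η.nonneg_normed η.integral_normed hg.aestronglyMeasurable
    fun y (_ : y ∈ Metric.ball x η.rOut) => by simpa using hgC y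

theorem classicalPartial_normed_convolution (i : Fin d) {ψ : E d → ℝ} {C : NNReal}
    (hψ : LipschitzWith C ψ) (x : E d) :
    classicalPartial i (η.normed volume ⋆[lsmul ℝ ℝ, volume] ψ) x
      = (η.normed volume ⋆[lsmul ℝ ℝ, volume] classicalPartial i ψ) x := by
  let e : E d := EuclideanSpace.single i 1
  let ρ : E d → ℝ := η.normed volume
  have hρ : ContDiff ℝ 1 ρ := η.contDiff_normed
  have hρc : HasCompactSupport ρ := η.hasCompactSupport_normed
  have hρe : ∀ t, lineDeriv ℝ ρ t e = fderiv ℝ ρ t e := fun t =>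
    (hρ.differentiable one_ne_zero t).lineDeriv_eq_fderiv
  obtain ⟨D, hD⟩ := hρ.lipschitzWith_of_hasCompactSupport hρc one_ne_zero
  have hψx : LipschitzWith C fun t => ψ (x - t) := by
    simpa using! hψ.comp (IsometryEquiv.subLeft x).isometry.lipschitz
  have hline : ∀ t, lineDeriv ℝ (fun t => ψ (x - t)) t (-e) = lineDeriv ℝ ψ (x - t) e := by
    intro t
    have harg : ∀ s : ℝ, x - (t + s • -e) = x - t + s • e := fun s => by module
    simp only [lineDeriv, harg]
  have hae : ∀ᵐ t, lineDeriv ℝ ψ (x - t) e = classicalPartial i ψ (x - t) := by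
    filter_upwards [(quasiMeasurePreserving_sub_left_of_right_invariant volume x).ae
      hψ.ae_differentiableAt] with t ht using ht.lineDeriv_eq_fderiv
  have hconv := hρc.hasFDerivAt_convolution_left (lsmul ℝ ℝ) hρ
    (hψ.continuous.locallyIntegrable (μ := volume)) x
  have hexists := (hρc.fderiv (𝕜 := ℝ)).convolutionExists_left
    ((lsmul ℝ ℝ : ℝ →L[ℝ] ℝ →L[ℝ] ℝ).precompL (E d)) (hρ.continuous_fderiv one_ne_zero)
    (hψ.continuous.locallyIntegrable (μ := volume)) x
  calc classicalPartial i (ρ ⋆[lsmul ℝ ℝ, volume] ψ) x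
      = ∫ t, lineDeriv ℝ ρ t (- -e) * ψ (x - t) := by
        rw [classicalPartial, hconv.fderiv, convolution,
          ContinuousLinearMap.integral_apply hexists]
        simp only [neg_neg, hρe, ContinuousLinearMap.precompL_apply,
          ContinuousLinearMap.lsmul_apply, smul_eq_mul, e]
    _ = ∫ t, lineDeriv ℝ (fun t => ψ (x - t)) t (-e) * ρ t :=
        (hψx.integral_lineDeriv_mul_eq hD hρc (-e)).symm
    _ = ∫ t, ρ t * classicalPartial i ψ (x - t) := by
        refine integral_congr_ae ?_
        filter_upwards [hae] with t ht
        rw [hline, ht, mul_comm]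
    _ = (ρ ⋆[lsmul ℝ ℝ, volume] classicalPartial i ψ) x := rfl

end Mollification

theorem tendsto_setIntegral_mul_of_bounded {u : E d → ℝ} (hu : LocallyIntegrableOn u Ω volume)
    {S : Set (E d)} (hS : IsCompact S) (hSΩ : S ⊆ Ω) {F : ℕ → E d → ℝ} {f : E d → ℝ} {C : ℝ}
    (hF : ∀ n, Measurable (F n)) (hFS : ∀ n, tsupport (F n) ⊆ S) (hFC : ∀ n x, |F n x| ≤ C)
    (hlim : ∀ᵐ x, Tendsto (fun n => F n x) atTop (𝓝 (f x))) :
    Tendsto (fun n => ∫ x in Ω, u x * F n x) atTop (𝓝 (∫ x in Ω, u x * f x)) := by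
  have hbound : Integrable (S.indicator fun x => |u x| * C) (volume.restrict Ω) :=
    ((integrable_indicator_iff hS.measurableSet).2
      ((hu.integrableOn_compact_subset hSΩ hS).abs.mul_const C)).restrict
  refine tendsto_integral_of_dominated_convergence _
    (fun n => hu.aestronglyMeasurable.mul (hF n).aestronglyMeasurable) hbound
    (fun n => Eventually.of_forall fun x => ?_)
    ((ae_restrict_of_ae hlim).mono fun x hx => hx.const_mul _)
  by_cases hx : x ∈ S
  · rw [Set.indicator_of_mem hx, norm_mul]
    exact mul_le_mul_of_nonneg_left (hFC n x) (norm_nonneg _)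
  · simp [image_eq_zero_of_notMem_tsupport fun h => hx (hFS n h), hx]

theorem HasWeakPartial.integral_mul_lipschitz (hΩ : IsOpen Ω) {i : Fin d} {u g : E d → ℝ}
    (h : HasWeakPartial Ω i u g) {ψ : E d → ℝ} {C : NNReal} (hψ : LipschitzWith C ψ)
    (hc : HasCompactSupport ψ) (hs : tsupport ψ ⊆ Ω) :
    ∫ x in Ω, u x * classicalPartial i ψ x = - ∫ x in Ω, g x * ψ x := by
  obtain ⟨δ, hδ, hδΩ⟩ := hc.isCompact.exists_cthickening_subset_open hΩ hs
  let η : ℕ → ContDiffBump (0 : E d) := fun n =>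
    ⟨δ / (n + 1) / 2, δ / (n + 1), by positivity, half_lt_self (by positivity)⟩
  have hη : Tendsto (fun n => (η n).rOut) atTop (𝓝 0) := by
    exact ((tendsto_const_div_atTop_nhds_zero_nat δ).comp (tendsto_add_atTop_nat 1)).congr
      fun n => by simp [η]
  have hηδ : ∀ n, (η n).rOut ≤ δ := fun n =>
    div_le_self hδ.le (le_add_of_nonneg_left n.cast_nonneg)
  let Ψ : ℕ → E d → ℝ := fun n =>
    convolution ((η n).normed volume) ψ (ContinuousLinearMap.lsmul ℝ ℝ) volume
  have hthick : ∀ n, Metric.cthickening (η n).rOut (tsupport ψ) ⊆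
      Metric.cthickening δ (tsupport ψ) := fun n => Metric.cthickening_mono (hηδ n) _
  have hΨ : ∀ n, IsTest Ω (Ψ n) := fun n =>
    isTest_normed_convolution (η n) hψ.continuous hc ((hthick n).trans hδΩ)
  have hΨS : ∀ n, tsupport (Ψ n) ⊆ Metric.cthickening δ (tsupport ψ) := fun n =>
    (tsupport_normed_convolution_subset (η n) ψ).trans (hthick n)
  obtain ⟨M, hM⟩ := hψ.continuous.bounded_above_of_compact_support hc
  have hpartial : ∀ x, |classicalPartial i ψ x| ≤ C := fun x =>
    abs_classicalPartial_le (Eventually.of_forall fun y => hψ.dist_le_mul y x)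
  have hlocint : LocallyIntegrable (classicalPartial i ψ) :=
    (locallyIntegrable_const (C : ℝ)).mono
      (measurable_classicalPartial i ψ).aestronglyMeasurable
      (Eventually.of_forall fun x => by simpa using hpartial x)
  have hlim_partial : Tendsto (fun n => ∫ x in Ω, u x * classicalPartial i (Ψ n) x) atTop
      (𝓝 (∫ x in Ω, u x * classicalPartial i ψ x)) := by
    refine tendsto_setIntegral_mul_of_bounded (C := C) h.1 hc.isCompact.cthickening hδΩ
      (fun n => measurable_classicalPartial i _)
      (fun n => (tsupport_fderiv_apply_subset ℝ _).trans (hΨS n)) (fun n x => ?_) ?_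
    · rw [classicalPartial_normed_convolution (η n) i hψ]
      exact abs_normed_convolution_le _ (measurable_classicalPartial i ψ) C.coe_nonneg hpartial x
    · simp only [Ψ, classicalPartial_normed_convolution _ i hψ]
      exact ContDiffBump.ae_convolution_tendsto_right_of_locallyIntegrable (K := 2) hη
        (Eventually.of_forall fun n => (mul_div_cancel₀ _ two_ne_zero).ge) hlocint
  have hlim : Tendsto (fun n => ∫ x in Ω, g x * Ψ n x) atTop (𝓝 (∫ x in Ω, g x * ψ x)) :=
    tendsto_setIntegral_mul_of_bounded h.2.1 hc.isCompact.cthickening hδΩ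
      (fun n => (hΨ n).1.continuous.measurable) hΨS
      (fun n => abs_normed_convolution_le (η n) hψ.continuous.measurable
        ((norm_nonneg _).trans (hM 0)) hM)
      (Eventually.of_forall
        (ContDiffBump.convolution_tendsto_right_of_continuous hη hψ.continuous))
  exact tendsto_nhds_unique hlim_partial (hlim.neg.congr fun n => (h.2.2 _ (hΨ n)).symm)

/-! ### Test functions and weak derivatives -/

theorem IsTest.classicalPartial {φ : E d → ℝ} (hφ : IsTest Ω φ) (i : Fin d) :
    IsTest Ω (classicalPartial i φ) :=
  ⟨(hφ.1.fderiv_right (by simp)).clm_apply contDiff_const, hφ.2.1.fderiv_apply ℝ _,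
    (tsupport_fderiv_apply_subset ℝ _).trans hφ.2.2⟩

theorem IsTest.linear_comb {φ ψ : E d → ℝ} (hφ : IsTest Ω φ) (hψ : IsTest Ω ψ) (s t : ℝ) :
    IsTest Ω (fun x => s * φ x + t * ψ x) := by
  refine ⟨(contDiff_const.mul hφ.1).add (contDiff_const.mul hψ.1),
    (hφ.2.1.mul_left (f := fun _ => s)).add (hψ.2.1.mul_left (f := fun _ => t)),
    (tsupport_add _ _).trans (Set.union_subset ?_ ?_)⟩
  · exact (tsupport_mul_subset_right (f := fun _ => s)).trans hφ.2.2
  · exact (tsupport_mul_subset_right (f := fun _ => t)).trans hψ.2.2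

theorem IsTest.classicalPartial_linear_comb {φ ψ : E d → ℝ} (hφ : IsTest Ω φ) (hψ : IsTest Ω ψ)
    (s t : ℝ) (i : Fin d) (x : E d) :
    DBF.classicalPartial i (fun x => s * φ x + t * ψ x) x
      = s * DBF.classicalPartial i φ x + t * DBF.classicalPartial i ψ x := by
  have hφx := hφ.1.differentiable (by simp) x
  have hψx := hψ.1.differentiable (by simp) x
  simp only [DBF.classicalPartial]
  rw [fderiv_fun_add (hφx.const_mul s) (hψx.const_mul t), fderiv_const_mul hφx,
    fderiv_const_mul hψx]
  simp

theorem IsTest.memLp {φ : E d → ℝ} (hφ : IsTest Ω φ) (p : ENNReal) :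
    MemLp φ p (volume.restrict Ω) :=
  hφ.1.continuous.memLp_of_hasCompactSupport hφ.2.1

theorem IsTest.integrable_mul {u φ : E d → ℝ} (hφ : IsTest Ω φ)
    (hu : LocallyIntegrableOn u Ω volume) :
    Integrable (fun x => u x * φ x) (volume.restrict Ω) := by
  have hsupp : Function.support (fun x => u x * φ x) ⊆ tsupport φ :=
    (Function.support_mul_subset_right u φ).trans (subset_tsupport φ)
  exact ((integrableOn_iff_integrable_of_support_subset hsupp).1
    ((hu.integrableOn_compact_subset hφ.2.2 hφ.2.1).mul_continuousOn
      hφ.1.continuous.continuousOn hφ.2.1)).restrict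

theorem HasWeakPartial.ae_unique (hΩ : IsOpen Ω) {i : Fin d} {u g g' : E d → ℝ}
    (h : HasWeakPartial Ω i u g) (h' : HasWeakPartial Ω i u g') :
    g =ᵐ[volume.restrict Ω] g' := by
  have hzero := hΩ.ae_eq_zero_of_integral_contDiff_smul_eq_zero (h.2.1.sub h'.2.1)
    fun φ hφ hc hs => by
      have htest : IsTest Ω φ := ⟨hφ, hc, hs⟩
      have hsupp : ∀ x ∉ Ω, φ x • (g - g') x = 0 := fun x hx => by
        rw [image_eq_zero_of_notMem_tsupport fun hx' => hx (hs hx'), zero_smul]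
      have hweak := (h.2.2 φ htest).symm.trans (h'.2.2 φ htest)
      rw [← setIntegral_eq_integral_of_forall_compl_eq_zero hsupp]
      simp only [Pi.sub_apply, smul_eq_mul, mul_comm (φ _), sub_mul]
      rw [integral_sub (htest.integrable_mul h.2.1) (htest.integrable_mul h'.2.1)]
      linarith
  filter_upwards [(ae_restrict_iff' hΩ.measurableSet).2 hzero] with x hx using sub_eq_zero.1 hx

theorem HasWeakPartial.weakPartial_ae_eq (hΩ : IsOpen Ω) {i : Fin d} {u g : E d → ℝ}
    (h : HasWeakPartial Ω i u g) : weakPartial Ω i u =ᵐ[volume.restrict Ω] g := by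
  have hex : ∃ g, HasWeakPartial Ω i u g := ⟨g, h⟩
  rw [weakPartial, dif_pos hex]
  exact hex.choose_spec.ae_unique hΩ h

theorem HasWeakPartial.linear_comb {i : Fin d} {u v g k : E d → ℝ}
    (hu : HasWeakPartial Ω i u g) (hv : HasWeakPartial Ω i v k) (s t : ℝ) :
    HasWeakPartial Ω i (fun x => s * u x + t * v x) (fun x => s * g x + t * k x) := by
  refine ⟨(hu.1.smul s).add (hv.1.smul t), (hu.2.1.smul s).add (hv.2.1.smul t), fun φ hφ => ?_⟩
  have hφi := hφ.classicalPartial i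
  simp only [add_mul, mul_assoc]
  rw [integral_add ((hφi.integrable_mul hu.1).const_mul s) ((hφi.integrable_mul hv.1).const_mul t),
    integral_add ((hφ.integrable_mul hu.2.1).const_mul s) ((hφ.integrable_mul hv.2.1).const_mul t)]
  simp only [integral_const_mul, hu.2.2 φ hφ, hv.2.2 φ hφ]
  ring

theorem MemH1.hasWeakPartial {u : E d → ℝ} (h : MemH1 Ω u) (i : Fin d) :
    HasWeakPartial Ω i u (weakPartial Ω i u) := by
  have hex : ∃ g, HasWeakPartial Ω i u g := (h.2 i).imp fun _ => And.left
  rw [weakPartial, dif_pos hex]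
  exact hex.choose_spec

theorem MemH1.memLp_weakPartial (hΩ : IsOpen Ω) {u : E d → ℝ} (h : MemH1 Ω u) (i : Fin d) :
    MemLp (weakPartial Ω i u) 2 (volume.restrict Ω) := by
  obtain ⟨g, hg, hg2⟩ := h.2 i
  exact (memLp_congr_ae (hg.weakPartial_ae_eq hΩ)).2 hg2

theorem MemH1.linear_comb (hΩ : IsOpen Ω) {u v : E d → ℝ} (hu : MemH1 Ω u) (hv : MemH1 Ω v)
    (s t : ℝ) : MemH1 Ω (fun x => s * u x + t * v x) :=
  ⟨(hu.1.const_mul s).add (hv.1.const_mul t), fun i =>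
    ⟨_, (hu.hasWeakPartial i).linear_comb (hv.hasWeakPartial i) s t,
      ((hu.memLp_weakPartial hΩ i).const_mul s).add ((hv.memLp_weakPartial hΩ i).const_mul t)⟩⟩

theorem MemH1.weakPartial_linear_comb (hΩ : IsOpen Ω) {u v : E d → ℝ} (hu : MemH1 Ω u)
    (hv : MemH1 Ω v) (s t : ℝ) (i : Fin d) :
    weakPartial Ω i (fun x => s * u x + t * v x) =ᵐ[volume.restrict Ω]
      fun x => s * weakPartial Ω i u x + t * weakPartial Ω i v x :=
  ((hu.hasWeakPartial i).linear_comb (hv.hasWeakPartial i) s t).weakPartial_ae_eq hΩ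

theorem tendsto_eLpNorm_linear_comb {μ : Measure (E d)} {u v : E d → ℝ} {p q : ℕ → E d → ℝ}
    (hu : AEStronglyMeasurable u μ) (hv : AEStronglyMeasurable v μ)
    (hp : ∀ n, AEStronglyMeasurable (p n) μ) (hq : ∀ n, AEStronglyMeasurable (q n) μ)
    (hup : Tendsto (fun n => eLpNorm (fun x => u x - p n x) 2 μ) atTop (𝓝 0))
    (hvq : Tendsto (fun n => eLpNorm (fun x => v x - q n x) 2 μ) atTop (𝓝 0)) (s t : ℝ) :
    Tendsto (fun n => eLpNorm (fun x => (s * u x + t * v x) - (s * p n x + t * q n x)) 2 μ)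
      atTop (𝓝 0) := by
  have hlim : Tendsto (fun n => ‖s‖ₑ * eLpNorm (fun x => u x - p n x) 2 μ
      + ‖t‖ₑ * eLpNorm (fun x => v x - q n x) 2 μ) atTop (𝓝 0) := by
    simpa using (ENNReal.Tendsto.const_mul hup (Or.inr (enorm_ne_top (x := s)))).add
      (ENNReal.Tendsto.const_mul hvq (Or.inr (enorm_ne_top (x := t))))
  refine tendsto_of_tendsto_of_tendsto_of_le_of_le tendsto_const_nhds hlim
    (fun _ => zero_le) fun n => ?_
  calc eLpNorm (fun x => (s * u x + t * v x) - (s * p n x + t * q n x)) 2 μ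
      = eLpNorm ((s • fun x => u x - p n x) + (t • fun x => v x - q n x)) 2 μ := by
        congr 1
        funext x
        simp only [Pi.add_apply, Pi.smul_apply, smul_eq_mul]
        ring
    _ ≤ eLpNorm (s • fun x => u x - p n x) 2 μ + eLpNorm (t • fun x => v x - q n x) 2 μ :=
        eLpNorm_add_le ((hu.sub (hp n)).const_smul s) ((hv.sub (hq n)).const_smul t) one_le_two
    _ = _ := by rw [eLpNorm_const_smul, eLpNorm_const_smul]

theorem MemH10.linear_comb (hΩ : IsOpen Ω) {u v : E d → ℝ} (hu : MemH10 Ω u) (hv : MemH10 Ω v)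
    (s t : ℝ) : MemH10 Ω (fun x => s * u x + t * v x) := by
  obtain ⟨hu1, φ, hφ, hφ0, hφ1⟩ := hu
  obtain ⟨hv1, ψ, hψ, hψ0, hψ1⟩ := hv
  refine ⟨hu1.linear_comb hΩ hv1 s t, fun n x => s * φ n x + t * ψ n x,
    fun n => (hφ n).linear_comb (hψ n) s t, ?_, fun i => ?_⟩
  · exact tendsto_eLpNorm_linear_comb hu1.1.1 hv1.1.1 (fun n => ((hφ n).memLp 2).1)
      (fun n => ((hψ n).memLp 2).1) hφ0 hψ0 s t
  · refine (tendsto_eLpNorm_linear_comb (hu1.memLp_weakPartial hΩ i).1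
      (hv1.memLp_weakPartial hΩ i).1 (fun n => (((hφ n).classicalPartial i).memLp 2).1)
      (fun n => (((hψ n).classicalPartial i).memLp 2).1) (hφ1 i) (hψ1 i) s t).congr
      fun n => eLpNorm_congr_ae ?_
    filter_upwards [hu1.weakPartial_linear_comb hΩ hv1 s t i] with x hx
    rw [hx, (hφ n).classicalPartial_linear_comb (hψ n) s t i x]

/-! ### Multiplication by functions in `W^{1,∞}` -/

/-- The space `W^{1,∞}(Ω)`, in terms of the precise representative: bounded functions on `Ω` whose
pointwise Lipschitz constants are bounded. Neither condition sees how far apart two points of `Ω`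
are inside `Ω`, so the functions need not be globally Lipschitz. -/
structure MemW1Top (Ω : Set (E d)) (ρ : E d → ℝ) : Prop where
  bdd : ∃ M : ℝ, ∀ x ∈ Ω, |ρ x| ≤ M
  lip : ∃ K : NNReal, ∀ x ∈ Ω, ∀ᶠ y in 𝓝 x, dist (ρ y) (ρ x) ≤ K * dist y x

theorem MemW1Top.continuousOn {ρ : E d → ℝ} (h : MemW1Top Ω ρ) : ContinuousOn ρ Ω := by
  obtain ⟨K, hK⟩ := h.lip
  exact fun x hx => continuousWithinAt_of_eventually_dist_le (nhdsWithin_le_nhds (hK x hx))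

theorem MemW1Top.memLp_top (hΩ : IsOpen Ω) {ρ : E d → ℝ} (h : MemW1Top Ω ρ) :
    MemLp ρ ⊤ (volume.restrict Ω) := by
  obtain ⟨M, hM⟩ := h.bdd
  exact memLp_top_of_bound (h.continuousOn.aestronglyMeasurable hΩ.measurableSet) M
    (ae_restrict_of_forall_mem hΩ.measurableSet hM)

theorem MemW1Top.memLp_top_classicalPartial (hΩ : IsOpen Ω) {ρ : E d → ℝ} (h : MemW1Top Ω ρ)
    (i : Fin d) : MemLp (classicalPartial i ρ) ⊤ (volume.restrict Ω) := by
  obtain ⟨K, hK⟩ := h.lip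
  exact memLp_top_of_bound (measurable_classicalPartial i ρ).aestronglyMeasurable K
    (ae_restrict_of_forall_mem hΩ.measurableSet fun x hx => abs_classicalPartial_le (hK x hx))

/-- Rademacher's theorem applies on the balls contained in `Ω`. -/
theorem MemW1Top.ae_differentiableAt (hΩ : IsOpen Ω) {ρ : E d → ℝ} (h : MemW1Top Ω ρ) :
    ∀ᵐ x ∂volume.restrict Ω, DifferentiableAt ℝ ρ x := by
  obtain ⟨K, hK⟩ := h.lip
  refine (ae_restrict_iff' hΩ.measurableSet).2 (ae_iff.2 (measure_null_of_locally_null _ ?_))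
  intro x hx
  obtain ⟨r, hr, hrΩ⟩ := Metric.isOpen_iff.1 hΩ x (by_contra fun h => hx fun h' => absurd h' h)
  have hlip : LipschitzOnWith K ρ (Metric.ball x r) :=
    lipschitzOnWith_of_eventually_dist_le (convex_ball x r)
      fun y hy => nhdsWithin_le_nhds (hK y (hrΩ hy))
  have hae : ∀ᵐ y, y ∈ Metric.ball x r → DifferentiableAt ℝ ρ y := by
    filter_upwards [(ae_restrict_iff' measurableSet_ball).1
      (hlip.ae_differentiableWithinAt (μ := volume) measurableSet_ball)] with y hy hyr
    exact (hy hyr).differentiableAt (Metric.isOpen_ball.mem_nhds hyr)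
  refine ⟨_, inter_mem_nhdsWithin _ (Metric.ball_mem_nhds x hr),
    measure_mono_null ?_ (ae_iff.1 hae)⟩
  exact fun y ⟨hy, hyr⟩ hdiff => hy fun _ => hdiff hyr

theorem MemW1Top.exists_lipschitzWith_mul {ρ φ : E d → ℝ} (hρ : MemW1Top Ω ρ)
    (hφ : IsTest Ω φ) : ∃ C, LipschitzWith C fun x => ρ x * φ x := by
  obtain ⟨M, hM⟩ := hρ.bdd
  obtain ⟨K, hK⟩ := hρ.lip
  obtain ⟨L, hL⟩ := hφ.1.lipschitzWith_of_hasCompactSupport hφ.2.1 (by simp)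
  obtain ⟨N, hN⟩ := hφ.1.continuous.bounded_above_of_compact_support hφ.2.1
  refine ⟨M.toNNReal * L + K * N.toNNReal, lipschitzOnWith_univ.1
    (lipschitzOnWith_of_eventually_dist_le convex_univ fun x _ => nhdsWithin_le_nhds ?_)⟩
  by_cases hx : x ∈ tsupport φ
  · filter_upwards [hK x (hφ.2.2 hx)] with y hy
    have hMx : |ρ x| ≤ M.toNNReal := (hM x (hφ.2.2 hx)).trans (Real.le_coe_toNNReal M)
    have hNy : |φ y| ≤ N.toNNReal := (hN y).trans (Real.le_coe_toNNReal N)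
    have hLy := hL.dist_le_mul y x
    simp only [Real.dist_eq (ρ y), Real.dist_eq (φ y), Real.dist_eq (ρ y * φ y)] at hy hLy ⊢
    calc |ρ y * φ y - ρ x * φ x| = |ρ x * (φ y - φ x) + (ρ y - ρ x) * φ y| := by ring_nf
      _ ≤ |ρ x| * |φ y - φ x| + |ρ y - ρ x| * |φ y| := by
        simpa only [abs_mul] using abs_add_le (ρ x * (φ y - φ x)) ((ρ y - ρ x) * φ y)
      _ ≤ M.toNNReal * (L * dist y x) + K * dist y x * N.toNNReal := by gcongr
      _ = _ := by push_cast; ring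
  · filter_upwards [notMem_tsupport_iff_eventuallyEq.1 hx] with y hy
    have hφx : φ x = 0 := image_eq_zero_of_notMem_tsupport hx
    simp only [hy, hφx, Pi.zero_apply, mul_zero, dist_self]
    positivity

theorem locallyIntegrableOn_mul_of_memLp_top {m u : E d → ℝ}
    (hm : MemLp m ⊤ (volume.restrict Ω)) (hu : LocallyIntegrableOn u Ω volume) :
    LocallyIntegrableOn (fun x => m x * u x) Ω volume := by
  intro x hx
  obtain ⟨s, hs, hus⟩ := hu x hx
  exact ⟨s ∩ Ω, inter_mem hs self_mem_nhdsWithin,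
    (hus.mono_set Set.inter_subset_left).mul_of_top_right
      (hm.mono_measure (Measure.restrict_mono Set.inter_subset_right le_rfl))⟩

theorem HasWeakPartial.mul_memW1Top (hΩ : IsOpen Ω) {i : Fin d} {u g ρ : E d → ℝ}
    (hu : HasWeakPartial Ω i u g) (hρ : MemW1Top Ω ρ) :
    HasWeakPartial Ω i (fun x => ρ x * u x)
      (fun x => classicalPartial i ρ x * u x + ρ x * g x) := by
  have hρu := locallyIntegrableOn_mul_of_memLp_top (hρ.memLp_top hΩ) hu.1
  have hρg := locallyIntegrableOn_mul_of_memLp_top (hρ.memLp_top hΩ) hu.2.1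
  have hρ'u := locallyIntegrableOn_mul_of_memLp_top (hρ.memLp_top_classicalPartial hΩ i) hu.1
  refine ⟨hρu, hρ'u.add hρg, fun φ hφ => ?_⟩
  obtain ⟨C, hC⟩ := hρ.exists_lipschitzWith_mul hφ
  have hweak := hu.integral_mul_lipschitz hΩ hC hφ.2.1.mul_left
    ((tsupport_mul_subset_right (f := ρ)).trans hφ.2.2)
  have hleibniz : ∫ x in Ω, u x * classicalPartial i (fun x => ρ x * φ x) x
      = ∫ x in Ω, (ρ x * u x * classicalPartial i φ x + classicalPartial i ρ x * u x * φ x) := by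
    refine integral_congr_ae ?_
    filter_upwards [hρ.ae_differentiableAt hΩ] with x hx
    simp only [classicalPartial, fderiv_fun_mul hx (hφ.1.differentiable (by simp) x),
      _root_.add_apply, _root_.smul_apply, smul_eq_mul]
    ring
  rw [hleibniz, integral_add ((hφ.classicalPartial i).integrable_mul hρu)
    (hφ.integrable_mul hρ'u)] at hweak
  simp only [add_mul]
  rw [integral_add (hφ.integrable_mul hρ'u) (hφ.integrable_mul hρg)]
  simp only [mul_left_comm (g _), ← mul_assoc] at hweak
  linarith

theorem hasWeakPartial_one (i : Fin d) : HasWeakPartial Ω i (fun _ => 1) (fun _ => 0) := by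
  refine ⟨locallyIntegrableOn_const 1, locallyIntegrableOn_const 0, fun φ hφ => ?_⟩
  have hint : ∀ {ψ : E d → ℝ}, IsTest Ω ψ → Integrable ψ := fun hψ =>
    hψ.1.continuous.integrable_of_hasCompactSupport hψ.2.1
  have hparts := integral_mul_fderiv_eq_neg_fderiv_mul_of_integrable (μ := volume)
    (f := fun _ : E d => (1 : ℝ)) (g := φ) (v := EuclideanSpace.single i 1) (by simp)
    (by simpa using! hint (hφ.classicalPartial i)) (by simpa using hint hφ) (by simp)
    fun x _ => hφ.1.differentiable (by simp) x
  rw [setIntegral_eq_integral_of_forall_compl_eq_zero fun x hx => by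
    rw [image_eq_zero_of_notMem_tsupport fun h => hx ((hφ.classicalPartial i).2.2 h), mul_zero]]
  simpa using! hparts

theorem MemW1Top.hasWeakPartial (hΩ : IsOpen Ω) {ρ : E d → ℝ} (hρ : MemW1Top Ω ρ) (i : Fin d) :
    HasWeakPartial Ω i ρ (classicalPartial i ρ) := by
  simpa using (hasWeakPartial_one i).mul_memW1Top hΩ hρ

theorem MemW1Top.memH1 (hΩ : IsOpen Ω) [IsFiniteMeasure (volume.restrict Ω)] {ρ : E d → ℝ}
    (hρ : MemW1Top Ω ρ) : MemH1 Ω ρ :=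
  ⟨(hρ.memLp_top hΩ).mono_exponent le_top, fun i => ⟨_, hρ.hasWeakPartial hΩ i,
    (hρ.memLp_top_classicalPartial hΩ i).mono_exponent le_top⟩⟩

theorem MemW1Top.weakPartial_ae_eq (hΩ : IsOpen Ω) {ρ : E d → ℝ} (hρ : MemW1Top Ω ρ)
    (i : Fin d) : weakPartial Ω i ρ =ᵐ[volume.restrict Ω] classicalPartial i ρ :=
  (hρ.hasWeakPartial hΩ i).weakPartial_ae_eq hΩ

theorem MemH1.mul_memW1Top (hΩ : IsOpen Ω) {u ρ : E d → ℝ} (hu : MemH1 Ω u)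
    (hρ : MemW1Top Ω ρ) : MemH1 Ω (fun x => ρ x * u x) :=
  ⟨hu.1.mul (hρ.memLp_top hΩ), fun i =>
    ⟨_, (hu.hasWeakPartial i).mul_memW1Top hΩ hρ,
      (hu.1.mul (hρ.memLp_top_classicalPartial hΩ i)).add
        ((hu.memLp_weakPartial hΩ i).mul (hρ.memLp_top hΩ))⟩⟩

theorem MemH1.weakPartial_mul_memW1Top (hΩ : IsOpen Ω) {u ρ : E d → ℝ} (hu : MemH1 Ω u)
    (hρ : MemW1Top Ω ρ) (i : Fin d) :
    weakPartial Ω i (fun x => ρ x * u x) =ᵐ[volume.restrict Ω]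
      fun x => weakPartial Ω i ρ x * u x + ρ x * weakPartial Ω i u x := by
  filter_upwards [((hu.hasWeakPartial i).mul_memW1Top hΩ hρ).weakPartial_ae_eq hΩ,
    hρ.weakPartial_ae_eq hΩ i] with x hmul hρx
  rw [hmul, hρx]

/-! ### Integration by parts -/

theorem tendsto_integral_mul_of_tendsto_eLpNorm {α : Type*} [MeasurableSpace α] {μ : Measure α}
    {f u : α → ℝ} {p : ℕ → α → ℝ} (hf : MemLp f 2 μ) (hu : AEStronglyMeasurable u μ)
    (hp : ∀ n, MemLp (p n) 2 μ)
    (h : Tendsto (fun n => eLpNorm (fun x => u x - p n x) 2 μ) atTop (𝓝 0)) :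
    Tendsto (fun n => ∫ x, f x * p n x ∂μ) atTop (𝓝 (∫ x, f x * u x ∂μ)) := by
  have hlim := ENNReal.Tendsto.const_mul h (Or.inr hf.eLpNorm_ne_top)
  rw [mul_zero] at hlim
  refine tendsto_integral_of_L1' _ (hf.1.mul hu)
    (Eventually.of_forall fun n => hf.integrable_mul (hp n))
    (tendsto_of_tendsto_of_tendsto_of_le_of_le tendsto_const_nhds hlim (fun _ => zero_le) ?_)
  intro n
  calc eLpNorm ((fun x => f x * p n x) - fun x => f x * u x) 1 μ
      = eLpNorm (f • fun x => u x - p n x) 1 μ := by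
        rw [eLpNorm_sub_comm]
        congr 1
        funext x
        simp only [Pi.sub_apply, Pi.smul_apply', smul_eq_mul]
        ring
    _ ≤ _ := eLpNorm_smul_le_mul_eLpNorm (hu.sub (hp n).1) hf.1

theorem MemH1.integral_weakPartial_mul (hΩ : IsOpen Ω) {U φ : E d → ℝ} (hU : MemH1 Ω U)
    (hφ : MemH10 Ω φ) (i : Fin d) :
    ∫ x in Ω, weakPartial Ω i U x * φ x = - ∫ x in Ω, U x * weakPartial Ω i φ x := by
  obtain ⟨hφ1, ψ, hψ, hψ0, hψ1⟩ := hφ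
  have hleft := tendsto_integral_mul_of_tendsto_eLpNorm (hU.memLp_weakPartial hΩ i) hφ1.1.1
    (fun n => (hψ n).memLp 2) hψ0
  have hright := tendsto_integral_mul_of_tendsto_eLpNorm hU.1 (hφ1.memLp_weakPartial hΩ i).1
    (fun n => ((hψ n).classicalPartial i).memLp 2) (hψ1 i)
  refine tendsto_nhds_unique hleft (hright.neg.congr fun n => ?_)
  rw [(hU.hasWeakPartial i).2.2 (ψ n) (hψ n), neg_neg]

/-- The component-wise reason why the convection term is skew-symmetric. -/
theorem MemH1.integral_convection (hΩ : IsOpen Ω) {U v : E d → ℝ} (hU : MemH1 Ω U)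
    (hv : MemW1Top Ω v) (hv0 : MemH10 Ω v) (i : Fin d) :
    ∫ x in Ω, (weakPartial Ω i U x * (v x * v x) + 2 * (U x * weakPartial Ω i v x * v x)) = 0 := by
  have hvU := hU.mul_memW1Top hΩ hv
  have hparts := hvU.integral_weakPartial_mul hΩ hv0 i
  rw [eq_neg_iff_add_eq_zero] at hparts
  refine Eq.trans (integral_congr_ae ?_) ((integral_add
    ((hvU.memLp_weakPartial hΩ i).integrable_mul hv0.1.1)
    (hvU.1.integrable_mul (hv0.1.memLp_weakPartial hΩ i))).trans hparts)
  filter_upwards [hU.weakPartial_mul_memW1Top hΩ hv i] with x hx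
  simp only [Pi.mul_apply, hx]
  ring

/-! ### Triangulations -/

theorem ext_apply_of_mem {F : Type} [Zero F] (v : closure Ω → F) {x : E d} (hx : x ∈ closure Ω) :
    ext v x = v ⟨x, hx⟩ :=
  Subtype.val_injective.extend_apply v 0 ⟨x, hx⟩

theorem ext_apply_of_notMem {F : Type} [Zero F] (v : closure Ω → F) {x : E d}
    (hx : x ∉ closure Ω) : ext v x = 0 :=
  Function.extend_apply' (f := Subtype.val) v 0 x fun ⟨a, ha⟩ => hx (ha ▸ a.2)

theorem continuousOn_ext {F : Type} [Zero F] [TopologicalSpace F] (v : C(closure Ω, F)) :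
    ContinuousOn (ext v) (closure Ω) := by
  rw [continuousOn_iff_continuous_domRestrict]
  convert! v.continuous using 1
  funext x
  exact ext_apply_of_mem v x.2

theorem Elt.isCompact_carrier (κ : Elt d) : IsCompact κ.carrier :=
  (Set.finite_range _).isCompact_convexHull _

theorem Elt.isClosed_carrier (κ : Elt d) : IsClosed κ.carrier := κ.isCompact_carrier.isClosed

theorem Elt.convex_carrier (κ : Elt d) : Convex ℝ κ.carrier := convex_convexHull ℝ _

theorem Elt.mem_carrier_iff (κ : Elt d) {x : E d} : x ∈ κ.carrier ↔ ∀ i, 0 ≤ κ.coord i x := by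
  rw [Elt.carrier, Elt.vertices, AffineBasis.convexHull_eq_nonneg_coord, Set.mem_ofPred_eq]

theorem Elt.mem_interior_iff (κ : Elt d) {x : E d} :
    x ∈ interior κ.carrier ↔ ∀ i, 0 < κ.coord i x := by
  rw [Elt.carrier, Elt.vertices, AffineBasis.interior_convexHull, Set.mem_ofPred_eq]

theorem Elt.nonempty_interior (κ : Elt d) : (interior κ.carrier).Nonempty :=
  ⟨_, AffineBasis.centroid_mem_interior_convexHull κ⟩

theorem Elt.ae_notMem_frontier (κ : Elt d) : ∀ᵐ x, x ∉ frontier κ.carrier :=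
  measure_eq_zero_iff_ae_notMem.1 (κ.convex_carrier.addHaar_frontier volume)

theorem Elt.ncard_vertices (κ : Elt d) : κ.vertices.ncard = d + 1 := by
  rw [Elt.vertices, ← Set.image_univ, Set.ncard_image_of_injective _ κ.ind.injective,
    Set.ncard_univ, Nat.card_fin]

theorem Triangulation.carrier_subset (T : Triangulation Ω) {κ : Elt d} (hκ : κ ∈ T.elts) :
    κ.carrier ⊆ closure Ω :=
  T.union ▸ Set.subset_biUnion_of_mem (u := fun κ : Elt d => κ.carrier) hκ

theorem Triangulation.interior_subset (T : Triangulation Ω) (hΩr : interior (closure Ω) = Ω)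
    {κ : Elt d} (hκ : κ ∈ T.elts) : interior κ.carrier ⊆ Ω :=
  hΩr ▸ interior_mono (T.carrier_subset hκ)

theorem Triangulation.isCompact_closure (T : Triangulation Ω) : IsCompact (closure Ω) :=
  T.union ▸ T.elts.isCompact_biUnion fun κ _ => κ.isCompact_carrier

theorem Triangulation.isFiniteMeasure (T : Triangulation Ω) :
    IsFiniteMeasure (volume.restrict Ω) :=
  isFiniteMeasure_restrict.2
    ((measure_mono subset_closure).trans_lt T.isCompact_closure.measure_lt_top).ne

theorem Triangulation.exists_mem (T : Triangulation Ω) {x : E d} (hx : x ∈ closure Ω) :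
    ∃ κ ∈ T.elts, x ∈ κ.carrier := by
  simpa only [← T.union, Set.mem_iUnion, exists_prop] using hx

theorem Triangulation.exists_vertex_notMem (T : Triangulation Ω) {κ κ' : Elt d}
    (hκ : κ ∈ T.elts) (hκ' : κ' ∈ T.elts) (hne : κ ≠ κ') : ∃ i, κ i ∉ κ'.vertices := by
  by_contra! hsub
  refine hne (T.injOn hκ hκ' (Set.eq_of_subset_of_ncard_le (Set.range_subset_iff.2 hsub) ?_
    (Set.finite_range _)))
  rw [κ.ncard_vertices, κ'.ncard_vertices]

/-! ### The local spaces of the mini-element -/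

theorem exists_eval_eq_affine {σ R : Type*} [Fintype σ] [CommSemiring R] {p : MvPolynomial σ R}
    (hp : p.totalDegree ≤ 1) : ∃ (a₀ : R) (a : σ → R), ∀ y : σ → R,
      MvPolynomial.eval y p = a₀ + ∑ i, a i * y i := by
  classical
  have hmono : ∀ m ∈ p.support, ∃ (b₀ : R) (b : σ → R), ∀ y : σ → R,
      MvPolynomial.eval y (MvPolynomial.monomial m (p.coeff m)) = b₀ + ∑ i, b i * y i := by
    intro m hm
    rcases Nat.le_one_iff_eq_zero_or_eq_one.1 ((MvPolynomial.le_totalDegree hm).trans hp) with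
      h0 | h1
    · rw [(Finsupp.degree_eq_zero_iff m).1 h0]
      exact ⟨p.coeff 0, 0, fun y => by simp⟩
    · obtain ⟨i, rfl⟩ := (Finsupp.sum_eq_one_iff m).1 h1
      exact ⟨0, Pi.single i (p.coeff (Finsupp.single i 1)), fun y => by
        simp [Pi.single_apply, MvPolynomial.eval_monomial]⟩
  choose! b₀ b hb using hmono
  refine ⟨∑ m ∈ p.support, b₀ m, fun i => ∑ m ∈ p.support, b m i, fun y => ?_⟩
  conv_lhs => rw [p.as_sum, map_sum, Finset.sum_congr rfl fun m hm => hb m hm y]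
  simp only [Finset.sum_add_distrib, Finset.sum_mul]
  rw [Finset.sum_comm]

theorem totalDegree_linear_comb_le {σ R : Type*} [CommSemiring R] {p q : MvPolynomial σ R}
    {n : ℕ} (hp : p.totalDegree ≤ n) (hq : q.totalDegree ≤ n) (s t : R) :
    (s • p + t • q).totalDegree ≤ n :=
  (MvPolynomial.totalDegree_add _ _).trans (max_le
    ((MvPolynomial.totalDegree_smul_le _ _).trans hp)
    ((MvPolynomial.totalDegree_smul_le _ _).trans hq))

theorem IsP1On.exists_affine {K : Set (E d)} {g : E d → ℝ} (h : IsP1On K g) :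
    ∃ (a₀ : ℝ) (a : Fin d → ℝ), ∀ x ∈ K, g x = a₀ + ∑ i, a i * x i := by
  obtain ⟨p, hp, hg⟩ := h
  obtain ⟨a₀, a, ha⟩ := exists_eval_eq_affine hp
  exact ⟨a₀, a, fun x hx => (hg x hx).trans (ha _)⟩

theorem IsP1On.linear_comb {K : Set (E d)} {g k : E d → ℝ} (hg : IsP1On K g) (hk : IsP1On K k)
    (s t : ℝ) : IsP1On K (fun x => s * g x + t * k x) := by
  obtain ⟨p, hp, hg⟩ := hg
  obtain ⟨q, hq, hk⟩ := hk
  refine ⟨s • p + t • q, totalDegree_linear_comb_le hp hq s t, fun x hx => ?_⟩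
  simp only [hg x hx, hk x hx, map_add, MvPolynomial.smul_eval]

theorem IsP1On.isMiniOn {κ : Elt d} {g : E d → ℝ} (h : IsP1On κ.carrier g) : IsMiniOn κ g := by
  obtain ⟨p, hp, hg⟩ := h
  exact ⟨p, hp, 0, fun x hx => by rw [hg x hx, zero_mul, add_zero]⟩

theorem IsMiniOn.linear_comb {κ : Elt d} {g k : E d → ℝ} (hg : IsMiniOn κ g) (hk : IsMiniOn κ k)
    (s t : ℝ) : IsMiniOn κ (fun x => s * g x + t * k x) := by
  obtain ⟨p, hp, c, hg⟩ := hg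
  obtain ⟨q, hq, e, hk⟩ := hk
  refine ⟨s • p + t • q, totalDegree_linear_comb_le hp hq s t, s * c + t * e, fun x hx => ?_⟩
  simp only [hg x hx, hk x hx, map_add, MvPolynomial.smul_eval]
  ring

theorem isP1On_zero {K : Set (E d)} : IsP1On K (fun _ => 0) := ⟨0, by simp, by simp⟩

theorem Elt.contDiff_bubble (κ : Elt d) : ContDiff ℝ ∞ κ.bubble :=
  contDiff_prod fun i _ => (smooth_barycentric_coord κ i).of_le le_top

theorem IsMiniOn.exists_lipschitzOnWith {κ : Elt d} {g : E d → ℝ} (h : IsMiniOn κ g) :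
    ∃ K, LipschitzOnWith K g κ.carrier := by
  obtain ⟨p, hp, c, hg⟩ := h
  obtain ⟨a₀, a, ha⟩ := exists_eval_eq_affine hp
  have hsmooth : ContDiff ℝ 1 fun x : E d => a₀ + ∑ i, a i * x i + c * κ.bubble x := by
    have := κ.contDiff_bubble.of_le (by simp : (1 : WithTop ℕ∞) ≤ ∞)
    fun_prop
  obtain ⟨K, hK⟩ := hsmooth.locallyLipschitz.locallyLipschitzOn
    |>.exists_lipschitzOnWith_of_compact κ.isCompact_carrier
  exact ⟨K, fun x hx y hy => by simpa only [hg x hx, hg y hy, ha] using hK hx hy⟩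

theorem Triangulation.memW1Top (T : Triangulation Ω) (hΩ : IsOpen Ω) {g : E d → ℝ}
    (hc : ContinuousOn g (closure Ω)) (hg : ∀ κ ∈ T.elts, IsMiniOn κ g) : MemW1Top Ω g := by
  choose! K hK using fun κ hκ => (hg κ hκ).exists_lipschitzOnWith
  constructor
  · obtain ⟨M, hM⟩ := T.isCompact_closure.exists_bound_of_continuousOn hc
    exact ⟨M, fun x hx => hM x (subset_closure hx)⟩
  · refine ⟨∑ κ ∈ T.elts, K κ, fun x hx => ?_⟩
    have hlip := eventually_dist_le_of_finite_closed_cover (K := ∑ κ ∈ T.elts, K κ)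
      (fun κ (_ : κ ∈ T.elts) => κ.isClosed_carrier)
      (fun κ hκ => (hK κ hκ).weaken (Finset.single_le_sum (fun _ _ => zero_le) hκ)) x
    rw [T.union] at hlip
    rwa [nhdsWithin_eq_nhds.2 (mem_of_superset (hΩ.mem_nhds hx) subset_closure)] at hlip

theorem classicalPartial_affine (a₀ : ℝ) (a : Fin d → ℝ) (i : Fin d) (x : E d) :
    classicalPartial i (fun y => a₀ + ∑ j, a j * y j) x = a i := by
  let L : E d →L[ℝ] ℝ := ∑ j, a j • EuclideanSpace.proj j
  have hL : (fun y : E d => a₀ + ∑ j, a j * y j) = fun y => a₀ + L y := by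
    funext y
    simp [L]
  rw [classicalPartial, hL, (L.hasFDerivAt.const_add a₀).fderiv]
  simp [L]

/-! ### Bubble functions -/

/-- The bubble function of `κ`, extended by zero outside `κ`. -/
def Elt.extBubble (κ : Elt d) : E d → ℝ := κ.carrier.indicator κ.bubble

theorem Elt.extBubble_of_mem (κ : Elt d) {x : E d} (hx : x ∈ κ.carrier) :
    κ.extBubble x = κ.bubble x :=
  Set.indicator_of_mem hx _

theorem Elt.extBubble_of_notMem (κ : Elt d) {x : E d} (hx : x ∉ κ.carrier) : κ.extBubble x = 0 :=
  Set.indicator_of_notMem hx _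

theorem Elt.extBubble_nonneg (κ : Elt d) (x : E d) : 0 ≤ κ.extBubble x :=
  Set.indicator_nonneg (fun _ hx => Finset.prod_nonneg fun i _ => κ.mem_carrier_iff.1 hx i) x

theorem Elt.support_extBubble (κ : Elt d) :
    Function.support κ.extBubble = interior κ.carrier := by
  refine Set.Subset.antisymm (fun x hx => κ.mem_interior_iff.2 fun i => ?_) fun x hx => ?_
  · have hxκ : x ∈ κ.carrier := Set.mem_of_indicator_ne_zero hx
    rw [Function.mem_support, κ.extBubble_of_mem hxκ, Elt.bubble, Finset.prod_ne_zero_iff] at hx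
    exact (κ.mem_carrier_iff.1 hxκ i).lt_of_ne' (hx i (Finset.mem_univ i))
  · rw [Function.mem_support, κ.extBubble_of_mem (interior_subset hx)]
    exact (Finset.prod_pos fun i _ => κ.mem_interior_iff.1 hx i).ne'

theorem Elt.continuous_extBubble (κ : Elt d) : Continuous κ.extBubble := by
  refine continuous_indicator (fun x hx => ?_) κ.contDiff_bubble.continuous.continuousOn
  rw [← κ.extBubble_of_mem (κ.isClosed_carrier.frontier_subset hx), ← Function.notMem_support,
    κ.support_extBubble]
  exact hx.2

theorem Elt.bubble_eq_zero_of_mem_convexHull (κ : Elt d) {S : Set (E d)} (hS : S ⊆ κ.vertices)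
    {i : Fin (d + 1)} (hi : κ i ∉ S) {x : E d} (hx : x ∈ convexHull ℝ S) : κ.bubble x = 0 := by
  have hconv : Convex ℝ (κ.coord i ⁻¹' {0}) := (convex_singleton 0).affine_preimage _
  refine Finset.prod_eq_zero (Finset.mem_univ i) (convexHull_min (fun y hy => ?_) hconv hx)
  obtain ⟨j, rfl⟩ := hS hy
  exact κ.coord_apply_ne fun hij => hi (hij ▸ hy)

theorem Triangulation.isMiniOn_extBubble (T : Triangulation Ω) {κ κ' : Elt d} (hκ : κ ∈ T.elts)
    (hκ' : κ' ∈ T.elts) : IsMiniOn κ' κ.extBubble := by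
  by_cases hne : κ = κ'
  · subst hne
    exact ⟨0, by simp, 1, fun x hx => by simp [κ.extBubble_of_mem hx]⟩
  · refine ⟨0, by simp, 0, fun x hx => ?_⟩
    rw [map_zero, zero_mul, add_zero]
    by_cases hxκ : x ∈ κ.carrier
    · obtain ⟨i, hi⟩ := T.exists_vertex_notMem hκ hκ' hne
      rw [κ.extBubble_of_mem hxκ]
      refine κ.bubble_eq_zero_of_mem_convexHull Set.inter_subset_left (fun h => hi h.2) ?_
      rw [← T.inter κ hκ κ' hκ' hne]
      exact ⟨hxκ, hx⟩
    · exact κ.extBubble_of_notMem hxκ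

theorem Triangulation.memW1Top_extBubble (T : Triangulation Ω) (hΩ : IsOpen Ω) {κ : Elt d}
    (hκ : κ ∈ T.elts) : MemW1Top Ω κ.extBubble :=
  T.memW1Top hΩ κ.continuous_extBubble.continuousOn fun _ hκ' => T.isMiniOn_extBubble hκ hκ'

/-! ### Bubble functions belong to `H¹₀` -/

theorem tendsto_eLpNorm_zero_of_bounded {α : Type*} [MeasurableSpace α] {μ : Measure α}
    [IsFiniteMeasure μ] {f : ℕ → α → ℝ} (hf : ∀ n, AEStronglyMeasurable (f n) μ) {C : ℝ}
    (hC : ∀ n, ∀ᵐ x ∂μ, |f n x| ≤ C) (hlim : ∀ᵐ x ∂μ, ∀ᶠ n in atTop, f n x = 0) :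
    Tendsto (fun n => eLpNorm (f n) 2 μ) atTop (𝓝 0) := by
  have hint : Tendsto (fun n => ∫⁻ x, ‖f n x‖ₑ ^ (2 : ℝ) ∂μ) atTop (𝓝 (∫⁻ _, 0 ∂μ)) := by
    refine tendsto_lintegral_of_dominated_convergence' (fun _ => ‖C‖ₑ ^ (2 : ℝ))
      (fun n => (hf n).enorm.pow_const _) (fun n => ?_) ?_ ?_
    · filter_upwards [hC n] with x hx
      exact ENNReal.rpow_le_rpow (enorm_le_iff_norm_le.2 (hx.trans (le_abs_self C))) zero_le_two
    · rw [lintegral_const]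
      exact ENNReal.mul_ne_top (ENNReal.rpow_ne_top_of_nonneg zero_le_two enorm_ne_top)
        (measure_ne_top _ _)
    · filter_upwards [hlim] with x hx
      refine tendsto_const_nhds.congr' ?_
      filter_upwards [hx] with n hn
      simp [hn]
  have hroot := hint.ennrpow_const (1 / 2)
  rw [lintegral_zero, ENNReal.zero_rpow_of_pos one_half_pos] at hroot
  refine hroot.congr fun n => ?_
  rw [eLpNorm_eq_lintegral_rpow_enorm_toReal two_ne_zero ENNReal.ofNat_ne_top, ENNReal.toReal_ofNat]

theorem MemW1Top.memH10_of_eventuallyEq (hΩ : IsOpen Ω) [IsFiniteMeasure (volume.restrict Ω)]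
    {u : E d → ℝ} (hu : MemW1Top Ω u) {φ : ℕ → E d → ℝ} (hφ : ∀ n, IsTest Ω (φ n)) {M : ℝ}
    (hM : ∀ n, ∀ x ∈ Ω, |φ n x| ≤ M) {K : NNReal}
    (hK : ∀ n, ∀ x ∈ Ω, ∀ᶠ y in 𝓝 x, dist (φ n y) (φ n x) ≤ K * dist y x)
    (hlim : ∀ᵐ x ∂volume.restrict Ω, ∀ᶠ n in atTop, φ n =ᶠ[𝓝 x] u) : MemH10 Ω u := by
  obtain ⟨Mu, hMu⟩ := hu.bdd
  obtain ⟨Ku, hKu⟩ := hu.lip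
  refine ⟨hu.memH1 hΩ, φ, hφ, ?_, fun i => ?_⟩
  · refine tendsto_eLpNorm_zero_of_bounded (C := Mu + M)
      (fun n => (hu.memLp_top hΩ).1.sub ((hφ n).memLp 2).1)
      (fun n => ae_restrict_of_forall_mem hΩ.measurableSet fun x hx =>
        (abs_sub _ _).trans (add_le_add (hMu x hx) (hM n x hx))) ?_
    filter_upwards [hlim] with x hx
    filter_upwards [hx] with n hn using sub_eq_zero.2 hn.eq_of_nhds.symm
  · have hweak := hu.weakPartial_ae_eq hΩ i
    refine tendsto_eLpNorm_zero_of_bounded (C := Ku + K)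
      (fun n => ((hu.memH1 hΩ).memLp_weakPartial hΩ i).1.sub
        (measurable_classicalPartial i _).aestronglyMeasurable) (fun n => ?_) ?_
    · filter_upwards [hweak, ae_restrict_mem hΩ.measurableSet] with x hx hxΩ
      rw [hx]
      exact (abs_sub _ _).trans
        (add_le_add (abs_classicalPartial_le (hKu x hxΩ)) (abs_classicalPartial_le (hK n x hxΩ)))
    · filter_upwards [hlim, hweak] with x hx hxweak
      filter_upwards [hx] with n hn
      rw [hxweak, classicalPartial, classicalPartial, hn.fderiv_eq, sub_self]

/-- A smooth function on `ℝ` that vanishes on `(-∞, 1]` and is the identity on `[2, ∞)`. -/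
def truncId (y : ℝ) : ℝ := y * Real.smoothTransition (y - 1)

theorem contDiff_truncId : ContDiff ℝ ∞ truncId :=
  contDiff_id.mul (Real.smoothTransition.contDiff.comp (contDiff_id.sub contDiff_const))

theorem truncId_of_le_one {y : ℝ} (hy : y ≤ 1) : truncId y = 0 := by
  rw [truncId, Real.smoothTransition.zero_of_nonpos (sub_nonpos.2 hy), mul_zero]

theorem truncId_of_two_le {y : ℝ} (hy : 2 ≤ y) : truncId y = y := by
  rw [truncId, Real.smoothTransition.one_of_one_le (by linarith), mul_one]

theorem abs_truncId_le (y : ℝ) : |truncId y| ≤ |y| := by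
  rw [truncId, abs_mul, abs_of_nonneg (Real.smoothTransition.nonneg _)]
  exact mul_le_of_le_one_right (abs_nonneg _) (Real.smoothTransition.le_one _)

theorem exists_lipschitzWith_truncId : ∃ C, LipschitzWith C truncId := by
  obtain ⟨C, hC⟩ := isCompact_Icc.exists_bound_of_continuousOn (s := Set.Icc (1 : ℝ) 2)
    (contDiff_truncId.continuous_deriv (by simp)).continuousOn
  have hbound : ∀ y, ‖deriv truncId y‖ ≤ max C 1 := by
    intro y
    rcases lt_or_ge y 1 with h1 | h1
    · have hzero : truncId =ᶠ[𝓝 y] fun _ => 0 := by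
        filter_upwards [Iio_mem_nhds h1] with z hz using truncId_of_le_one (le_of_lt hz)
      simp [hzero.deriv_eq]
    rcases le_or_gt y 2 with h2 | h2
    · exact (hC y ⟨h1, h2⟩).trans (le_max_left _ _)
    · have hid : truncId =ᶠ[𝓝 y] id := by
        filter_upwards [Ioi_mem_nhds h2] with z hz using truncId_of_two_le (le_of_lt hz)
      simp [hid.deriv_eq]
  exact ⟨(max C 1).toNNReal, lipschitzWith_of_nnnorm_deriv_le
    (contDiff_truncId.differentiable (by simp))
    fun y => (Real.le_toNNReal_iff_coe_le (by positivity)).2 (hbound y)⟩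

/-- Rescaled truncations, which tend to the identity on `[0, ∞)`. -/
def trunc (n : ℕ) (t : ℝ) : ℝ := (n + 1 : ℝ)⁻¹ * truncId ((n + 1) * t)

theorem contDiff_trunc (n : ℕ) : ContDiff ℝ ∞ (trunc n) :=
  contDiff_const.mul (contDiff_truncId.comp (contDiff_const.mul contDiff_id))

theorem trunc_of_mul_le_one {n : ℕ} {t : ℝ} (ht : (n + 1) * t ≤ 1) : trunc n t = 0 := by
  rw [trunc, truncId_of_le_one ht, mul_zero]

theorem trunc_of_two_le_mul {n : ℕ} {t : ℝ} (ht : 2 ≤ (n + 1) * t) : trunc n t = t := by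
  rw [trunc, truncId_of_two_le ht, inv_mul_cancel_left₀ (by positivity)]

theorem abs_trunc_le (n : ℕ) (t : ℝ) : |trunc n t| ≤ |t| := by
  have hn : (0 : ℝ) < n + 1 := by positivity
  rw [trunc, abs_mul, abs_of_pos (inv_pos.2 hn), inv_mul_le_iff₀ hn]
  exact (abs_truncId_le _).trans_eq (by rw [abs_mul, abs_of_pos hn])

theorem exists_lipschitzWith_trunc : ∃ C, ∀ n, LipschitzWith C (trunc n) := by
  obtain ⟨C, hC⟩ := exists_lipschitzWith_truncId
  refine ⟨C, fun n => LipschitzWith.of_dist_le_mul fun s t => ?_⟩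
  have hn : (0 : ℝ) < n + 1 := by positivity
  have hst := hC.dist_le_mul ((n + 1) * s) ((n + 1) * t)
  simp only [Real.dist_eq, trunc, ← mul_sub, abs_mul, abs_of_pos hn, abs_of_pos (inv_pos.2 hn)]
    at hst ⊢
  rw [inv_mul_le_iff₀ hn]
  linarith

theorem isTest_trunc_comp {u : E d → ℝ} (hu : Continuous u) (hc : HasCompactSupport u)
    (hs : Function.support u ⊆ Ω) (hsmooth : ∀ x, u x ≠ 0 → ContDiffAt ℝ ∞ u x) (n : ℕ) :
    IsTest Ω (fun x => trunc n (u x)) := by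
  have hcont : Continuous fun x => (n + 1 : ℝ) * u x := hu.const_mul _
  have hsupp : tsupport (fun x => trunc n (u x)) ⊆ {x | 1 ≤ (n + 1 : ℝ) * u x} :=
    closure_minimal (fun x hx => (not_le.1 fun h => hx (trunc_of_mul_le_one h)).le)
      (isClosed_le continuous_const hcont)
  refine ⟨contDiff_iff_contDiffAt.2 fun x => ?_,
    hc.comp_left (g := trunc n) (trunc_of_mul_le_one (by simp)), fun x hx => hs fun hux => ?_⟩
  · by_cases hux : u x = 0
    · have hlt : ∀ᶠ y in 𝓝 x, (n + 1 : ℝ) * u y < 1 :=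
        hcont.continuousAt.eventually_lt continuousAt_const (by simp [hux])
      have hzero : (fun y => trunc n (u y)) =ᶠ[𝓝 x] fun _ => 0 := by
        filter_upwards [hlt] with y hy using trunc_of_mul_le_one hy.le
      exact contDiffAt_const.congr_of_eventuallyEq hzero
    · exact (contDiff_trunc n).contDiffAt.comp x (hsmooth x hux)
  · have hone : (1 : ℝ) ≤ (n + 1) * u x := hsupp hx
    rw [hux, mul_zero] at hone
    exact zero_lt_one.not_ge hone

theorem eventually_trunc_comp_eventuallyEq {u : E d → ℝ} (hu : Continuous u) (h0 : ∀ x, 0 ≤ u x)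
    {x : E d} (hx : x ∉ frontier (Function.support u)) :
    ∀ᶠ n in atTop, (fun y => trunc n (u y)) =ᶠ[𝓝 x] u := by
  rcases (h0 x).eq_or_lt' with hux | hux
  · have hzero : u =ᶠ[𝓝 x] 0 := notMem_tsupport_iff_eventuallyEq.1 fun h =>
      hx ⟨h, fun h' => interior_subset h' hux⟩
    refine Eventually.of_forall fun n => ?_
    filter_upwards [hzero] with y hy
    rw [hy, Pi.zero_apply, trunc_of_mul_le_one (by simp)]
  · have hlarge : Tendsto (fun n : ℕ => ((n : ℝ) + 1) * u x) atTop atTop :=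
      (tendsto_atTop_add_const_right _ _ tendsto_natCast_atTop_atTop).atTop_mul_const hux
    filter_upwards [hlarge.eventually_gt_atTop 2] with n hn
    filter_upwards [continuousAt_const.eventually_lt (hu.const_mul _).continuousAt hn] with y hy
      using trunc_of_two_le_mul hy.le

theorem MemW1Top.memH10_of_contDiffAt (hΩ : IsOpen Ω) [IsFiniteMeasure (volume.restrict Ω)]
    {u : E d → ℝ} (hu : MemW1Top Ω u) (hcont : Continuous u) (h0 : ∀ x, 0 ≤ u x)
    (hc : HasCompactSupport u) (hs : Function.support u ⊆ Ω)
    (hnull : ∀ᵐ x, x ∉ frontier (Function.support u))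
    (hsmooth : ∀ x, u x ≠ 0 → ContDiffAt ℝ ∞ u x) : MemH10 Ω u := by
  obtain ⟨M, hM⟩ := hu.bdd
  obtain ⟨K, hK⟩ := hu.lip
  obtain ⟨C, hC⟩ := exists_lipschitzWith_trunc
  refine hu.memH10_of_eventuallyEq hΩ (K := C * K) (isTest_trunc_comp hcont hc hs hsmooth)
    (fun n x hx => (abs_trunc_le n _).trans (hM x hx)) (fun n x hx => ?_)
    ((ae_restrict_of_ae hnull).mono fun x => eventually_trunc_comp_eventuallyEq hcont h0)
  filter_upwards [hK x hx] with y hy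
  calc dist (trunc n (u y)) (trunc n (u x)) ≤ C * dist (u y) (u x) := (hC n).dist_le_mul _ _
    _ ≤ C * (K * dist y x) := by gcongr
    _ = (C * K : NNReal) * dist y x := by rw [NNReal.coe_mul, mul_assoc]

theorem Triangulation.memH10_extBubble (T : Triangulation Ω) (hΩ : IsOpen Ω)
    (hΩr : interior (closure Ω) = Ω) {κ : Elt d} (hκ : κ ∈ T.elts) : MemH10 Ω κ.extBubble := by
  have := T.isFiniteMeasure
  refine (T.memW1Top_extBubble hΩ hκ).memH10_of_contDiffAt hΩ κ.continuous_extBubble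
    κ.extBubble_nonneg (HasCompactSupport.intro κ.isCompact_carrier fun _ => κ.extBubble_of_notMem)
    (κ.support_extBubble.trans_subset (T.interior_subset hΩr hκ)) ?_ fun x hx => ?_
  · rw [κ.support_extBubble]
    filter_upwards [κ.ae_notMem_frontier] with x hx using fun h => hx (frontier_interior_subset h)
  · have hxκ : κ.carrier ∈ 𝓝 x := mem_interior_iff_mem_nhds.1 (κ.support_extBubble.subset hx)
    refine κ.contDiff_bubble.contDiffAt.congr_of_eventuallyEq ?_
    filter_upwards [hxκ] with y hy using κ.extBubble_of_mem hy

theorem memH10_zero (hΩ : IsOpen Ω) [IsFiniteMeasure (volume.restrict Ω)] :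
    MemH10 Ω (fun _ => 0) := by
  have hzero : MemW1Top Ω (fun _ => 0) := ⟨⟨0, by simp⟩, ⟨0, by simp⟩⟩
  have htest : IsTest Ω (fun _ => 0) := ⟨contDiff_const, HasCompactSupport.zero, by simp⟩
  exact hzero.memH10_of_eventuallyEq hΩ (fun _ => htest) (M := 0) (by simp) (K := 0) (by simp)
    (Eventually.of_forall fun _ => Eventually.of_forall fun _ => EventuallyEq.rfl)

/-! ### Coefficients -/

theorem AdmissibleCoeff.isBounded_image_Icc {ε₀ : ℝ} {α : ℝ → ℝ} (h : AdmissibleCoeff ε₀ α) :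
    Bornology.IsBounded (α '' Set.Icc ε₀ 1) := by
  obtain ⟨K, hK⟩ := h.deriv_bdd
  have hlip : LipschitzOnWith K.toNNReal α (Set.Ioo ε₀ 1) :=
    (convex_Ioo ε₀ 1).lipschitzOnWith_of_nnnorm_deriv_le h.diff fun t ht => by
      rw [← NNReal.coe_le_coe, coe_nnnorm, Real.norm_of_nonneg (h.deriv_pos t ht).le]
      exact (hK t ht).trans K.le_coe_toNNReal
  have hIoo : Bornology.IsBounded (α '' Set.Ioo ε₀ 1) := by
    rw [← Set.range_domRestrict, ← Set.image_univ]
    exact hlip.to_restrict.isBounded_image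
      (isometry_subtype_coe.antilipschitz.isBounded_preimage (Metric.isBounded_Ioo ε₀ 1) |>.subset
        fun t _ => t.2)
  have hends : ({ε₀, 1} : Set ℝ).Finite := Set.toFinite _
  refine ((hends.image α).isBounded.union hIoo).subset ?_
  rw [← Set.image_union]
  refine Set.image_mono fun t ht => ?_
  rcases Set.eq_endpoints_or_mem_Ioo_of_mem_Icc ht with rfl | rfl | ht
  · simp
  · simp
  · exact Or.inr ht

theorem AdmissibleCoeff.measurable_indicator {ε₀ : ℝ} {α : ℝ → ℝ} (h : AdmissibleCoeff ε₀ α) :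
    Measurable ((Set.Icc ε₀ 1).indicator α) := by
  classical
  have hIoo : Measurable ((Set.Ioo ε₀ 1).piecewise α 0) :=
    ContinuousOn.measurable_piecewise
      (fun t ht => (h.diff t ht).continuousAt.continuousWithinAt) continuousOn_const
      measurableSet_Ioo
  refine hIoo.measurable_of_countable_ne ((Set.toFinite {ε₀, 1}).countable.mono fun t ht => ?_)
  by_contra hends
  rw [Set.mem_insert_iff, Set.mem_singleton_iff, not_or] at hends
  have hiff : t ∈ Set.Ioo ε₀ 1 ↔ t ∈ Set.Icc ε₀ 1 :=
    ⟨fun h => ⟨h.1.le, h.2.le⟩, fun h => ⟨h.1.lt_of_ne' hends.1, h.2.lt_of_ne hends.2⟩⟩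
  exact ht (by simp only [Set.piecewise, Set.indicator, hiff, Pi.zero_apply]; congr)

theorem AdmissibleCoeff.memLp_top {X : Type*} [MeasurableSpace X] {μ : Measure X} {ε₀ : ℝ}
    {α : ℝ → ℝ} (h : AdmissibleCoeff ε₀ α) {ε : X → ℝ} (hε : AEMeasurable ε μ)
    (hbd : ∀ᵐ x ∂μ, ε x ∈ Set.Icc ε₀ 1) : MemLp (fun x => α (ε x)) ⊤ μ := by
  obtain ⟨M, hM⟩ := h.isBounded_image_Icc.exists_norm_le
  have hmeas : AEMeasurable (fun x => α (ε x)) μ :=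
    (h.measurable_indicator.comp_aemeasurable hε).congr
      (hbd.mono fun x hx => Set.indicator_of_mem hx α)
  exact memLp_top_of_bound hmeas.aestronglyMeasurable M
    (hbd.mono fun x hx => hM _ (Set.mem_image_of_mem α hx))

/-! ### Vector fields -/

/-- Vector-valued version of `MemW1Top`. -/
def MemW1TopVec (Ω : Set (E d)) (v : E d → E d) : Prop :=
  ∀ j : Fin d, MemW1Top Ω (fun x => v x j)

theorem inner_eq_sum (x y : E d) : inner ℝ x y = ∑ j, x j * y j := by
  simp only [PiLp.inner_apply, Real.inner_apply]

theorem inner_linear_comb_right (s t : ℝ) (x y z : E d) :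
    inner ℝ x (s • y + t • z) = s * inner ℝ x y + t * inner ℝ x z := by
  rw [inner_add_right, real_inner_smul_right, real_inner_smul_right]

theorem inner_linear_comb_left (s t : ℝ) (x y z : E d) :
    inner ℝ (s • y + t • z) x = s * inner ℝ y x + t * inner ℝ z x := by
  rw [inner_add_left, real_inner_smul_left, real_inner_smul_left]

theorem MemH1Vec.memLp {u : E d → E d} (hu : MemH1Vec Ω u) : MemLp u 2 (volume.restrict Ω) :=
  MemLp.of_eval_piLp fun j => (hu j).1

theorem MemH1Vec.linear_comb (hΩ : IsOpen Ω) {u v : E d → E d} (hu : MemH1Vec Ω u)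
    (hv : MemH1Vec Ω v) (s t : ℝ) : MemH1Vec Ω (fun x => s • u x + t • v x) :=
  fun j => (hu j).linear_comb hΩ (hv j) s t

theorem MemH1Vec.weakPartial_linear_comb (hΩ : IsOpen Ω) {u v : E d → E d} (hu : MemH1Vec Ω u)
    (hv : MemH1Vec Ω v) (s t : ℝ) :
    ∀ᵐ x ∂(volume.restrict Ω), ∀ i j, weakPartial Ω i (fun y => (s • u y + t • v y) j) x
      = s * weakPartial Ω i (fun y => u y j) x + t * weakPartial Ω i (fun y => v y j) x :=
  ae_all_iff.2 fun i => ae_all_iff.2 fun j => (hu j).weakPartial_linear_comb hΩ (hv j) s t i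

theorem MemH1Vec.smul_memW1Top (hΩ : IsOpen Ω) {ε : E d → ℝ} (hε : MemW1Top Ω ε)
    {u : E d → E d} (hu : MemH1Vec Ω u) : MemH1Vec Ω (fun y => ε y • u y) :=
  fun j => (hu j).mul_memW1Top hΩ hε

theorem MemH1Vec.memLp_weakDiv (hΩ : IsOpen Ω) {u : E d → E d} (hu : MemH1Vec Ω u) :
    MemLp (weakDiv Ω u) 2 (volume.restrict Ω) :=
  memLp_finsetSum _ fun i _ => (hu i).memLp_weakPartial hΩ i

theorem MemH1Vec.weakDiv_smul_linear_comb (hΩ : IsOpen Ω) {ε : E d → ℝ} (hε : MemW1Top Ω ε)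
    {u v : E d → E d} (hu : MemH1Vec Ω u) (hv : MemH1Vec Ω v) (s t : ℝ) :
    weakDiv Ω (fun y => ε y • (s • u y + t • v y)) =ᵐ[volume.restrict Ω]
      fun x => s * weakDiv Ω (fun y => ε y • u y) x + t * weakDiv Ω (fun y => ε y • v y) x := by
  have hsmul : (fun y => ε y • (s • u y + t • v y))
      = fun y => s • (ε y • u y) + t • (ε y • v y) :=
    funext fun y => by rw [smul_add, smul_comm (ε y) s, smul_comm (ε y) t]
  rw [hsmul]
  filter_upwards [(hu.smul_memW1Top hΩ hε).weakPartial_linear_comb hΩ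
    (hv.smul_memW1Top hΩ hε) s t] with x hx
  simp only [weakDiv, hx, Finset.sum_add_distrib, Finset.mul_sum]

/-! ### Linearity of the forms -/

theorem integral_linear_comb {X : Type*} [MeasurableSpace X] {μ : Measure X} {F F₁ F₂ : X → ℝ}
    (h₁ : Integrable F₁ μ) (h₂ : Integrable F₂ μ) {s t : ℝ}
    (h : ∀ᵐ x ∂μ, F x = s * F₁ x + t * F₂ x) :
    ∫ x, F x ∂μ = s * ∫ x, F₁ x ∂μ + t * ∫ x, F₂ x ∂μ := by
  rw [integral_congr_ae h, integral_add (h₁.const_mul s) (h₂.const_mul t), integral_const_mul,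
    integral_const_mul]

theorem integrable_mul_of_memLp_top {X : Type*} [MeasurableSpace X] {μ : Measure X}
    {m g : X → ℝ} (hm : MemLp m ⊤ μ) (hg : Integrable g μ) :
    Integrable (fun x => m x * g x) μ :=
  memLp_one_iff_integrable.1 (MemLp.mul (memLp_one_iff_integrable.2 hg) hm)

theorem integrable_inner {X : Type*} [MeasurableSpace X] {μ : Measure X} {u v : X → E d}
    (hu : MemLp u 2 μ) (hv : MemLp v 2 μ) : Integrable (fun x => inner ℝ (u x) (v x)) μ := by
  simp_rw [inner_eq_sum]
  exact integrable_finsetSum _ fun j _ => (hu.eval_piLp j).integrable_mul (hv.eval_piLp j)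

theorem MemH1Vec.memLp_inner (hΩ : IsOpen Ω) {u v : E d → E d} (hu : MemH1Vec Ω u)
    (hv : MemW1TopVec Ω v) : MemLp (fun x => inner ℝ (u x) (v x)) 2 (volume.restrict Ω) := by
  simp_rw [inner_eq_sum]
  exact memLp_finsetSum _ fun j _ => MemLp.mul ((hv j).memLp_top hΩ) (hu j).1

theorem MemH1Vec.integrable_grad (hΩ : IsOpen Ω) {u v : E d → E d} (hu : MemH1Vec Ω u)
    (hv : MemH1Vec Ω v) {m : E d → ℝ} (hm : MemLp m ⊤ (volume.restrict Ω)) :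
    Integrable (fun x => m x * ∑ i : Fin d, ∑ j : Fin d,
      weakPartial Ω i (fun y => u y j) x * weakPartial Ω i (fun y => v y j) x)
      (volume.restrict Ω) :=
  integrable_mul_of_memLp_top hm (integrable_finsetSum _ fun i _ => integrable_finsetSum _
    fun j _ => ((hu j).memLp_weakPartial hΩ i).integrable_mul ((hv j).memLp_weakPartial hΩ i))

theorem MemH1Vec.integrable_convection (hΩ : IsOpen Ω) {ε : E d → ℝ} (hε : MemW1Top Ω ε)
    {u v w : E d → E d} (hu : MemH1Vec Ω u) (hv : MemH1Vec Ω v) (hw : MemW1TopVec Ω w) :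
    Integrable (fun x => ε x * ∑ j : Fin d,
      (∑ i : Fin d, u x i * weakPartial Ω i (fun y => v y j) x) * w x j) (volume.restrict Ω) := by
  refine integrable_mul_of_memLp_top (hε.memLp_top hΩ) (integrable_finsetSum _ fun j _ => ?_)
  simp_rw [mul_comm _ (w _ j)]
  exact integrable_mul_of_memLp_top ((hw j).memLp_top hΩ) (integrable_finsetSum _ fun i _ =>
    (hu i).1.integrable_mul ((hv j).memLp_weakPartial hΩ i))

theorem MemH1Vec.integrable_weakDiv_mul (hΩ : IsOpen Ω) {ε : E d → ℝ} (hε : MemW1Top Ω ε)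
    {u v w : E d → E d} (hu : MemH1Vec Ω u) (hv : MemH1Vec Ω v) (hw : MemW1TopVec Ω w) :
    Integrable (fun x => weakDiv Ω (fun y => ε y • u y) x * inner ℝ (v x) (w x))
      (volume.restrict Ω) :=
  ((hu.smul_memW1Top hΩ hε).memLp_weakDiv hΩ).integrable_mul (hv.memLp_inner hΩ hw)

theorem MemH1Vec.integrable_norm_mul (hΩ : IsOpen Ω) {m : E d → ℝ}
    (hm : MemLp m ⊤ (volume.restrict Ω)) {u v w : E d → E d} (hu : MemH1Vec Ω u)
    (hv : MemH1Vec Ω v) (hw : MemW1TopVec Ω w) :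
    Integrable (fun x => m x * ‖u x‖ * inner ℝ (v x) (w x)) (volume.restrict Ω) :=
  (MemLp.mul (r := 2) hu.memLp.norm hm).integrable_mul (hv.memLp_inner hΩ hw)

theorem aForm_comm (Re : ℝ) (α : ℝ → ℝ) (ε : E d → ℝ) (u v : E d → E d) :
    aForm Ω Re α ε u v = aForm Ω Re α ε v u := by
  simp only [aForm, mul_comm (weakPartial Ω _ (fun y => u y _) _), real_inner_comm]

theorem aForm_linear_right (hΩ : IsOpen Ω) (Re : ℝ) {α : ℝ → ℝ} {ε : E d → ℝ}
    (hε : MemW1Top Ω ε) (hα : MemLp (fun x => α (ε x)) ⊤ (volume.restrict Ω)) {u v w : E d → E d}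
    (hu : MemH1Vec Ω u) (hv : MemH1Vec Ω v) (hw : MemH1Vec Ω w) (s t : ℝ) :
    aForm Ω Re α ε u (fun x => s • v x + t • w x)
      = s * aForm Ω Re α ε u v + t * aForm Ω Re α ε u w := by
  unfold aForm
  refine Eq.trans (congrArg₂ (fun A B => 1 / Re * A + B)
    (integral_linear_comb (s := s) (t := t) (hu.integrable_grad hΩ hv (hε.memLp_top hΩ))
      (hu.integrable_grad hΩ hw (hε.memLp_top hΩ)) ?_)
    (integral_linear_comb (s := s) (t := t)
      (integrable_mul_of_memLp_top hα (integrable_inner hu.memLp hv.memLp))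
      (integrable_mul_of_memLp_top hα (integrable_inner hu.memLp hw.memLp))
      (Eventually.of_forall fun x => ?_))) (by ring)
  · filter_upwards [hv.weakPartial_linear_comb hΩ hw s t] with x hx
    simp only [hx, mul_add, Finset.sum_add_distrib, Finset.mul_sum, mul_left_comm _ s,
      mul_left_comm _ t]
  · rw [inner_linear_comb_right]
    ring

theorem aForm_linear_left (hΩ : IsOpen Ω) (Re : ℝ) {α : ℝ → ℝ} {ε : E d → ℝ}
    (hε : MemW1Top Ω ε) (hα : MemLp (fun x => α (ε x)) ⊤ (volume.restrict Ω)) {u v w : E d → E d}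
    (hu : MemH1Vec Ω u) (hv : MemH1Vec Ω v) (hw : MemH1Vec Ω w) (s t : ℝ) :
    aForm Ω Re α ε (fun x => s • u x + t • v x) w
      = s * aForm Ω Re α ε u w + t * aForm Ω Re α ε v w := by
  rw [aForm_comm, aForm_linear_right hΩ Re hε hα hw hu hv, aForm_comm Re α ε w u,
    aForm_comm Re α ε w v]

theorem cForm_linear_middle (hΩ : IsOpen Ω) {β : ℝ → ℝ} {ε : E d → ℝ} (hε : MemW1Top Ω ε)
    (hβ : MemLp (fun x => β (ε x)) ⊤ (volume.restrict Ω)) {u v v' w : E d → E d}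
    (hu : MemH1Vec Ω u) (hv : MemH1Vec Ω v) (hv' : MemH1Vec Ω v') (hw : MemW1TopVec Ω w)
    (s t : ℝ) :
    cForm Ω β ε u (fun x => s • v x + t • v' x) w
      = s * cForm Ω β ε u v w + t * cForm Ω β ε u v' w := by
  unfold cForm
  refine Eq.trans (congr (congrArg₂ (fun A B C => A + 1 / 2 * B + C)
    (integral_linear_comb (s := s) (t := t) (hu.integrable_convection hΩ hε hv hw)
      (hu.integrable_convection hΩ hε hv' hw) ?_)
    (integral_linear_comb (s := s) (t := t) (hu.integrable_weakDiv_mul hΩ hε hv hw)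
      (hu.integrable_weakDiv_mul hΩ hε hv' hw) (Eventually.of_forall fun x => ?_)))
    (integral_linear_comb (s := s) (t := t) (hu.integrable_norm_mul hΩ hβ hv hw)
      (hu.integrable_norm_mul hΩ hβ hv' hw)
      (Eventually.of_forall fun x => ?_))) (by ring)
  · filter_upwards [hv.weakPartial_linear_comb hΩ hv' s t] with x hx
    simp only [hx, mul_add, add_mul, Finset.sum_add_distrib, Finset.mul_sum, Finset.sum_mul,
      mul_left_comm _ s, mul_left_comm _ t, mul_assoc]
  · rw [inner_linear_comb_left]
    ring
  · rw [inner_linear_comb_left]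
    ring

theorem cForm_linear_right (hΩ : IsOpen Ω) {β : ℝ → ℝ} {ε : E d → ℝ} (hε : MemW1Top Ω ε)
    (hβ : MemLp (fun x => β (ε x)) ⊤ (volume.restrict Ω)) {u v w w' : E d → E d}
    (hu : MemH1Vec Ω u) (hv : MemH1Vec Ω v) (hw : MemW1TopVec Ω w) (hw' : MemW1TopVec Ω w')
    (s t : ℝ) :
    cForm Ω β ε u v (fun x => s • w x + t • w' x)
      = s * cForm Ω β ε u v w + t * cForm Ω β ε u v w' := by
  unfold cForm
  refine Eq.trans (congr (congrArg₂ (fun A B C => A + 1 / 2 * B + C)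
    (integral_linear_comb (s := s) (t := t) (hu.integrable_convection hΩ hε hv hw)
      (hu.integrable_convection hΩ hε hv hw') (Eventually.of_forall fun x => ?_))
    (integral_linear_comb (s := s) (t := t) (hu.integrable_weakDiv_mul hΩ hε hv hw)
      (hu.integrable_weakDiv_mul hΩ hε hv hw') (Eventually.of_forall fun x => ?_)))
    (integral_linear_comb (s := s) (t := t) (hu.integrable_norm_mul hΩ hβ hv hw)
      (hu.integrable_norm_mul hΩ hβ hv hw')
      (Eventually.of_forall fun x => ?_))) (by ring)
  · simp only [PiLp.add_apply, PiLp.smul_apply, smul_eq_mul, mul_add, Finset.sum_add_distrib,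
      Finset.mul_sum, mul_left_comm _ s, mul_left_comm _ t]
  · rw [inner_linear_comb_right]
    ring
  · rw [inner_linear_comb_right]
    ring

theorem bForm_linear_left (hΩ : IsOpen Ω) {ε : E d → ℝ} (hε : MemW1Top Ω ε) {q : E d → ℝ}
    (hq : MemLp q 2 (volume.restrict Ω)) {v w : E d → E d} (hv : MemH1Vec Ω v)
    (hw : MemH1Vec Ω w) (s t : ℝ) :
    bForm Ω ε (fun x => s • v x + t • w x) q = s * bForm Ω ε v q + t * bForm Ω ε w q := by
  refine integral_linear_comb
    (((hv.smul_memW1Top hΩ hε).memLp_weakDiv hΩ).integrable_mul hq)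
    (((hw.smul_memW1Top hΩ hε).memLp_weakDiv hΩ).integrable_mul hq) ?_
  filter_upwards [hv.weakDiv_smul_linear_comb hΩ hε hw s t] with x hx
  rw [hx]
  exact (add_mul _ _ _).trans (by rw [mul_assoc, mul_assoc, Pi.mul_apply, Pi.mul_apply])

theorem bForm_linear_right (hΩ : IsOpen Ω) {ε : E d → ℝ} (hε : MemW1Top Ω ε) {p q : E d → ℝ}
    (hp : MemLp p 2 (volume.restrict Ω)) (hq : MemLp q 2 (volume.restrict Ω)) {v : E d → E d}
    (hv : MemH1Vec Ω v) (s t : ℝ) :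
    bForm Ω ε v (fun x => s * p x + t * q x) = s * bForm Ω ε v p + t * bForm Ω ε v q :=
  have hdiv := (hv.smul_memW1Top hΩ hε).memLp_weakDiv hΩ
  integral_linear_comb (hdiv.integrable_mul hp) (hdiv.integrable_mul hq)
    (Eventually.of_forall fun x => by simp only [Pi.mul_apply]; ring)

theorem lForm_linear (hΩ : IsOpen Ω) {ε : E d → ℝ} (hε : MemW1Top Ω ε) {f : E d → E d}
    (hf : MemLp f 2 (volume.restrict Ω)) {v w : E d → E d} (hv : MemH1Vec Ω v)
    (hw : MemH1Vec Ω w) (s t : ℝ) :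
    lForm Ω ε f (fun x => s • v x + t • w x) = s * lForm Ω ε f v + t * lForm Ω ε f w :=
  have hεf : MemLp (fun x => ε x • f x) 2 (volume.restrict Ω) := hf.smul (hε.memLp_top hΩ)
  integral_linear_comb (integrable_inner hεf hv.memLp) (integrable_inner hεf hw.memLp)
    (Eventually.of_forall fun _ => inner_linear_comb_right s t _ _ _)

/-! ### Energy identity and integration by parts of the pressure term -/

theorem MemH1Vec.integral_weakDiv_mul_inner_self (hΩ : IsOpen Ω) {U v : E d → E d}
    (hU : MemH1Vec Ω U) (hv : MemW1TopVec Ω v) (hv0 : MemH10Vec Ω v) :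
    ∫ x in Ω, (weakDiv Ω U x * inner ℝ (v x) (v x)
      + 2 * ∑ j, (∑ i, U x i * weakPartial Ω i (fun y => v y j) x) * v x j) = 0 := by
  have hint : ∀ i j, Integrable (fun x => weakPartial Ω i (fun y => U y i) x * (v x j * v x j)
      + 2 * (U x i * weakPartial Ω i (fun y => v y j) x * v x j)) (volume.restrict Ω) := by
    intro i j
    have hvj := (hv j).memLp_top hΩ
    have hconv := integrable_mul_of_memLp_top hvj
      ((hU i).1.integrable_mul ((hv0 j).1.memLp_weakPartial hΩ i))
    refine (((hU i).memLp_weakPartial hΩ i).integrable_mul (MemLp.mul (r := 2) (hv0 j).1.1 hvj)).add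
      (Integrable.const_mul ?_ 2)
    exact hconv.congr (Eventually.of_forall fun x => mul_comm _ _)
  calc
    _ = ∫ x in Ω, ∑ i, ∑ j, (weakPartial Ω i (fun y => U y i) x * (v x j * v x j)
          + 2 * (U x i * weakPartial Ω i (fun y => v y j) x * v x j)) := by
      simp only [inner_eq_sum, weakDiv, Finset.sum_add_distrib, Finset.mul_sum, Finset.sum_mul]
      refine integral_congr_ae (Eventually.of_forall fun x => ?_)
      exact congrArg₂ (· + ·) Finset.sum_comm Finset.sum_comm
    _ = ∑ i, ∑ j, ∫ x in Ω, (weakPartial Ω i (fun y => U y i) x * (v x j * v x j)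
          + 2 * (U x i * weakPartial Ω i (fun y => v y j) x * v x j)) := by
      rw [integral_finsetSum _ fun i _ => integrable_finsetSum _ fun j _ => hint i j]
      exact Finset.sum_congr rfl fun i _ => integral_finsetSum _ fun j _ => hint i j
    _ = 0 := Finset.sum_eq_zero fun i _ => Finset.sum_eq_zero fun j _ =>
      (hU i).integral_convection hΩ (hv j) (hv0 j) i

theorem cForm_self (hΩ : IsOpen Ω) {β : ℝ → ℝ} {ε : E d → ℝ} (hε : MemW1Top Ω ε)
    {u v : E d → E d} (hu : MemH1Vec Ω u) (hv : MemW1TopVec Ω v) (hv0 : MemH10Vec Ω v) :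
    cForm Ω β ε u v v = ∫ x in Ω, β (ε x) * ‖u x‖ * inner ℝ (v x) (v x) := by
  have hv1 : MemH1Vec Ω v := fun j => (hv0 j).1
  have hskew := (hu.smul_memW1Top hΩ hε).integral_weakDiv_mul_inner_self hΩ hv hv0
  rw [integral_linear_comb (s := 1) (t := 2) (hu.integrable_weakDiv_mul hΩ hε hv1 hv)
    (hu.integrable_convection hΩ hε hv1 hv) (Eventually.of_forall fun x => ?_)] at hskew
  · rw [cForm]
    linarith
  · simp only [PiLp.smul_apply, smul_eq_mul, one_mul, Finset.mul_sum, Finset.sum_mul, mul_assoc]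

theorem integral_weakPartial_mul_mul (hΩ : IsOpen Ω) [IsFiniteMeasure (volume.restrict Ω)]
    {ε p φ : E d → ℝ} (hε : MemW1Top Ω ε) (hp : MemW1Top Ω p) (hφ : MemH10 Ω φ) (j : Fin d) :
    ∫ x in Ω, weakPartial Ω j (fun y => ε y * φ y) x * p x
      = - ∫ x in Ω, ε x * weakPartial Ω j p x * φ x := by
  have hp1 := hp.memH1 hΩ
  have hpε := (hε.memH1 hΩ).mul_memW1Top hΩ hp
  have hεφ := hφ.1.mul_memW1Top hΩ hε
  have hi₁ : Integrable (fun x => weakPartial Ω j (fun y => p y * ε y) x * φ x)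
      (volume.restrict Ω) := (hpε.memLp_weakPartial hΩ j).integrable_mul hφ.1.1
  have hi₂ : Integrable (fun x => p x * ε x * weakPartial Ω j φ x) (volume.restrict Ω) :=
    hpε.1.integrable_mul (hφ.1.memLp_weakPartial hΩ j)
  have hi₃ : Integrable (fun x => weakPartial Ω j (fun y => ε y * φ y) x * p x)
      (volume.restrict Ω) := (hεφ.memLp_weakPartial hΩ j).integrable_mul hp1.1
  have hi₄ : Integrable (fun x => ε x * weakPartial Ω j p x * φ x) (volume.restrict Ω) :=
    (MemLp.mul (r := 2) (hp1.memLp_weakPartial hΩ j) (hε.memLp_top hΩ)).integrable_mul hφ.1.1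
  have hparts := hpε.integral_weakPartial_mul hΩ hφ j
  rw [eq_neg_iff_add_eq_zero, ← integral_add hi₁ hi₂] at hparts
  rw [eq_neg_iff_add_eq_zero, ← integral_add hi₃ hi₄, ← hparts]
  refine integral_congr_ae ?_
  filter_upwards [(hε.memH1 hΩ).weakPartial_mul_memW1Top hΩ hp j,
    hφ.1.weakPartial_mul_memW1Top hΩ hε j] with x hpεx hεφx
  rw [hpεx, hεφx]
  ring

theorem weakDiv_single (hΩ : IsOpen Ω) (j : Fin d) (φ : E d → ℝ) :
    weakDiv Ω (fun x => EuclideanSpace.single j (φ x)) =ᵐ[volume.restrict Ω]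
      weakPartial Ω j φ := by
  have hzero : ∀ᵐ x ∂volume.restrict Ω, ∀ i, weakPartial Ω i (fun _ => 0) x = 0 :=
    ae_all_iff.2 fun i => HasWeakPartial.weakPartial_ae_eq hΩ (by
      simpa using (hasWeakPartial_one (Ω := Ω) i).linear_comb (hasWeakPartial_one i) 0 0)
  filter_upwards [hzero] with x hx
  rw [weakDiv, Finset.sum_eq_single j (fun i _ hij => ?_) (by simp)]
  · simp only [PiLp.single_apply, if_true]
  · simpa only [PiLp.single_apply, hij, if_false] using hx i

theorem bForm_single (hΩ : IsOpen Ω) [IsFiniteMeasure (volume.restrict Ω)] {ε p φ : E d → ℝ}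
    (hε : MemW1Top Ω ε) (hφ : MemH10 Ω φ) (hp : MemW1Top Ω p) (j : Fin d) :
    bForm Ω ε (fun x => EuclideanSpace.single j (φ x)) p
      = - ∫ x in Ω, ε x * weakPartial Ω j p x * φ x := by
  have hsmul : (fun y => ε y • (EuclideanSpace.single j (φ y) : E d))
      = fun y => EuclideanSpace.single j (ε y * φ y) := by
    ext y k
    simp only [PiLp.smul_apply, PiLp.single_apply, smul_eq_mul, mul_ite, mul_zero]
  rw [← integral_weakPartial_mul_mul hΩ hε hp hφ, bForm, hsmul]
  refine integral_congr_ae ?_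
  filter_upwards [weakDiv_single hΩ j fun y => ε y * φ y] with x hx
  rw [hx]

/-! ### The discrete spaces as finite-dimensional vector spaces -/

theorem ext_zero {F : Type} [AddCommGroup F] [TopologicalSpace F] :
    ext (0 : C(closure Ω, F)) = fun _ => 0 := by
  funext x
  by_cases hx : x ∈ closure Ω
  · rw [ext_apply_of_mem _ hx, ContinuousMap.zero_apply]
  · exact ext_apply_of_notMem _ hx

theorem ext_linear_comb {F : Type} [AddCommGroup F] [Module ℝ F] [TopologicalSpace F]
    [IsTopologicalAddGroup F] [ContinuousConstSMul ℝ F] (s t : ℝ) (v w : C(closure Ω, F)) :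
    ext (s • v + t • w : C(closure Ω, F)) = fun x => s • ext v x + t • ext w x := by
  funext x
  by_cases hx : x ∈ closure Ω
  · simp only [ext_apply_of_mem _ hx, ContinuousMap.add_apply, ContinuousMap.smul_apply]
  · simp only [ext_apply_of_notMem _ hx, smul_zero, add_zero]

theorem zero_mem_X0h (hΩ : IsOpen Ω) (T : Triangulation Ω) : (0 : C(closure Ω, E d)) ∈ X0h T := by
  have := T.isFiniteMeasure
  refine ⟨fun κ _ j => ?_, fun j => ?_⟩ <;> rw [ext_zero]
  · exact isP1On_zero.isMiniOn
  · exact memH10_zero hΩ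

theorem X0h_linear_comb (hΩ : IsOpen Ω) {T : Triangulation Ω} {v w : C(closure Ω, E d)}
    (hv : v ∈ X0h T) (hw : w ∈ X0h T) (s t : ℝ) : s • v + t • w ∈ X0h T := by
  refine ⟨fun κ hκ j => ?_, fun j => ?_⟩ <;> rw [ext_linear_comb]
  · exact (hv.1 κ hκ j).linear_comb (hw.1 κ hκ j) s t
  · exact (hv.2 j).linear_comb hΩ (hw.2 j) s t

theorem zero_mem_M0h (T : Triangulation Ω) : (0 : C(closure Ω, ℝ)) ∈ M0h T := by
  refine ⟨fun κ _ => ?_, ?_, ?_⟩ <;> rw [ext_zero]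
  · exact isP1On_zero
  · exact MemLp.zero'
  · exact integral_zero _ _

theorem M0h_linear_comb {T : Triangulation Ω} {p q : C(closure Ω, ℝ)} (hp : p ∈ M0h T)
    (hq : q ∈ M0h T) (s t : ℝ) : s • p + t • q ∈ M0h T := by
  have := T.isFiniteMeasure
  refine ⟨fun κ hκ => ?_, ?_, ?_⟩ <;> rw [ext_linear_comb]
  · exact (hp.1 κ hκ).linear_comb (hq.1 κ hκ) s t
  · exact (hp.2.1.const_smul s).add (hq.2.1.const_smul t)
  · refine (integral_linear_comb (hp.2.1.integrable one_le_two) (hq.2.1.integrable one_le_two)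
      (Eventually.of_forall fun x => rfl)).trans ?_
    rw [hp.2.2, hq.2.2, mul_zero, mul_zero, add_zero]

/-- The velocity space `X_{0h}`, as a vector space. -/
def velocitySpace (hΩ : IsOpen Ω) (T : Triangulation Ω) : Submodule ℝ C(closure Ω, E d) :=
  Submodule.ofLinearComb (X0h T) ⟨0, zero_mem_X0h hΩ T⟩ fun _ hv _ hw s t =>
    X0h_linear_comb hΩ hv hw s t

/-- The pressure space `M_{0h}`, as a vector space. -/
def pressureSpace (T : Triangulation Ω) : Submodule ℝ C(closure Ω, ℝ) :=
  Submodule.ofLinearComb (M0h T) ⟨0, zero_mem_M0h T⟩ fun _ hp _ hq s t => M0h_linear_comb hp hq s t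

/-- The local space `P₁(κ) ⊕ Vect {b_κ}` of the mini-element, as a space of functions on the
closed simplex. -/
def Elt.miniSpace (κ : Elt d) : Submodule ℝ (κ.carrier → ℝ) :=
  Submodule.span ℝ ({1, fun x => κ.bubble x.1} ∪ Set.range fun i x => x.1 i)

instance Elt.finiteDimensional_miniSpace (κ : Elt d) : FiniteDimensional ℝ κ.miniSpace :=
  FiniteDimensional.span_of_finite ℝ ((Set.toFinite _).union (Set.finite_range _))

theorem IsMiniOn.mem_miniSpace {κ : Elt d} {g : E d → ℝ} (h : IsMiniOn κ g) :
    (fun x : κ.carrier => g x) ∈ κ.miniSpace := by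
  obtain ⟨p, hp, c, hg⟩ := h
  obtain ⟨a₀, a, ha⟩ := exists_eval_eq_affine hp
  have hsum : (fun x : κ.carrier => g x)
      = a₀ • 1 + ∑ i, a i • (fun x : κ.carrier => x.1 i) + c • fun x => κ.bubble x.1 := by
    funext x
    simp only [hg x x.2, ha, Pi.one_apply, Pi.add_apply, Pi.smul_apply, Finset.sum_apply,
      smul_eq_mul, mul_one]
  rw [hsum]
  exact add_mem (add_mem (Submodule.smul_mem _ _ (Submodule.subset_span (.inl (.inl rfl))))
    (sum_mem fun i _ => Submodule.smul_mem _ _ (Submodule.subset_span (.inr ⟨i, rfl⟩))))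
    (Submodule.smul_mem _ _ (Submodule.subset_span (.inl (.inr rfl))))

theorem finiteDimensional_of_isMiniOn {F ι : Type} [AddCommGroup F] [Module ℝ F]
    [TopologicalSpace F] [IsTopologicalAddGroup F] [ContinuousConstSMul ℝ F] [Finite ι]
    {ℓ : ι → F →ₗ[ℝ] ℝ} (hℓ : ∀ y z, (∀ j, ℓ j y = ℓ j z) → y = z) (T : Triangulation Ω)
    (S : Submodule ℝ C(closure Ω, F))
    (hS : ∀ v ∈ S, ∀ κ ∈ T.elts, ∀ j, IsMiniOn κ (fun x => ℓ j (ext v x))) :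
    FiniteDimensional ℝ S := by
  let R (k : T.elts × ι) : S →ₗ[ℝ] k.1.1.miniSpace := LinearMap.codRestrict _
    { toFun := fun v x => ℓ k.2 (v.1 ⟨x, T.carrier_subset k.1.2 x.2⟩)
      map_add' := fun v w => funext fun x => map_add (ℓ k.2) _ _
      map_smul' := fun s v => funext fun x => map_smul (ℓ k.2) _ _ } fun v => by
    convert (hS v.1 v.2 k.1.1 k.1.2 k.2).mem_miniSpace using 1
    exact funext fun x => by rw [ext_apply_of_mem v.1 (T.carrier_subset k.1.2 x.2)]; rfl
  refine Module.Finite.of_injective (LinearMap.pi R) fun v w hvw => ?_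
  refine Subtype.ext (ContinuousMap.ext fun x => hℓ _ _ fun j => ?_)
  obtain ⟨κ, hκ, hx⟩ := T.exists_mem x.2
  exact congrFun (congrArg Subtype.val (congrFun hvw (⟨κ, hκ⟩, j))) ⟨x, hx⟩

instance finiteDimensional_velocitySpace (hΩ : IsOpen Ω) (T : Triangulation Ω) :
    FiniteDimensional ℝ (velocitySpace hΩ T) :=
  finiteDimensional_of_isMiniOn (ℓ := fun j => (EuclideanSpace.proj (𝕜 := ℝ) j).toLinearMap)
    (fun _ _ h => PiLp.ext h) T _ fun _ hv => hv.1

instance finiteDimensional_pressureSpace (T : Triangulation Ω) :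
    FiniteDimensional ℝ (pressureSpace T) :=
  finiteDimensional_of_isMiniOn (ℓ := fun _ : Unit => LinearMap.id) (fun _ _ h => h ()) T _
    fun _ hp κ hκ _ => (hp.1 κ hκ).isMiniOn

/-! ### Uniqueness -/

theorem MemH1Vec.of_mem_X0h {T : Triangulation Ω} {v : C(closure Ω, E d)} (hv : v ∈ X0h T) :
    MemH1Vec Ω (ext v) :=
  fun j => (hv.2 j).1

theorem MemW1TopVec.of_mem_X0h (hΩ : IsOpen Ω) {T : Triangulation Ω} {v : C(closure Ω, E d)}
    (hv : v ∈ X0h T) : MemW1TopVec Ω (ext v) := fun j =>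
  T.memW1Top hΩ ((EuclideanSpace.proj (𝕜 := ℝ) j).continuous.comp_continuousOn (continuousOn_ext v))
    fun κ hκ => hv.1 κ hκ j

theorem MemW1Top.of_mem_Mh (hΩ : IsOpen Ω) {T : Triangulation Ω} {q : C(closure Ω, ℝ)}
    (hq : q ∈ Mh T) : MemW1Top Ω (ext q) :=
  T.memW1Top hΩ (continuousOn_ext q) fun κ hκ => (hq κ hκ).isMiniOn

theorem eq_zero_of_eqOn_zero {F : Type} [Zero F] [TopologicalSpace F] [T2Space F]
    {v : C(closure Ω, F)} (h : Set.EqOn (ext v) (fun _ => 0) Ω) : v = 0 := by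
  have hcl := h.of_subset_closure (continuousOn_ext v) continuousOn_const subset_closure subset_rfl
  exact ContinuousMap.ext fun x => (ext_apply_of_mem v x.2).symm.trans (hcl x.2)

theorem eq_zero_of_energy_nonpos (hΩ : IsOpen Ω) {T : Triangulation Ω} {Re : ℝ} (hRe : 0 ≤ Re)
    {α β : ℝ → ℝ} {ε : E d → ℝ} (hε : MemW1Top Ω ε) (hε0 : ∀ x ∈ Ω, 0 ≤ ε x)
    (hα : MemLp (fun x => α (ε x)) ⊤ (volume.restrict Ω)) (hα0 : ∀ x ∈ Ω, 0 < α (ε x))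
    (hβ0 : ∀ x ∈ Ω, 0 ≤ β (ε x)) {u : E d → E d} (hu : MemH1Vec Ω u) {v : C(closure Ω, E d)}
    (hv : v ∈ X0h T) (h : aForm Ω Re α ε (ext v) (ext v) + cForm Ω β ε u (ext v) (ext v) ≤ 0) :
    v = 0 := by
  have hv1 := (MemH1Vec.of_mem_X0h hv).memLp
  rw [cForm_self hΩ hε hu (.of_mem_X0h hΩ hv) hv.2, aForm] at h
  have hdiffusion : 0 ≤ ∫ x in Ω, ε x * ∑ i : Fin d, ∑ j : Fin d,
      weakPartial Ω i (fun y => ext v y j) x * weakPartial Ω i (fun y => ext v y j) x :=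
    setIntegral_nonneg hΩ.measurableSet fun x hx => mul_nonneg (hε0 x hx)
      (Finset.sum_nonneg fun i _ => Finset.sum_nonneg fun j _ => mul_self_nonneg _)
  have hforchheimer : 0 ≤ ∫ x in Ω, β (ε x) * ‖u x‖ * inner ℝ (ext v x) (ext v x) :=
    setIntegral_nonneg hΩ.measurableSet fun x hx =>
      mul_nonneg (mul_nonneg (hβ0 x hx) (norm_nonneg _)) real_inner_self_nonneg
  have hdarcy : 0 ≤ᵐ[volume.restrict Ω] fun x => α (ε x) * inner ℝ (ext v x) (ext v x) :=
    ae_restrict_of_forall_mem hΩ.measurableSet fun x hx =>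
      mul_nonneg (hα0 x hx).le real_inner_self_nonneg
  have hzero : ∫ x in Ω, α (ε x) * inner ℝ (ext v x) (ext v x) = 0 := by
    refine le_antisymm ?_ (integral_nonneg_of_ae hdarcy)
    have := mul_nonneg (one_div_nonneg.2 hRe) hdiffusion
    linarith
  rw [integral_eq_zero_iff_of_nonneg_ae hdarcy
    (integrable_mul_of_memLp_top hα (integrable_inner hv1 hv1))] at hzero
  have hae : ext v =ᵐ[volume.restrict Ω] fun _ => 0 := by
    filter_upwards [hzero, ae_restrict_mem hΩ.measurableSet] with x hx hxΩ
    exact inner_self_eq_zero.1 ((mul_eq_zero.1 hx).resolve_left (hα0 x hxΩ).ne')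
  exact eq_zero_of_eqOn_zero (Measure.eqOn_open_of_ae_eq hae hΩ
    ((continuousOn_ext v).mono subset_closure) continuousOn_const)

/-- The velocity field `b_κ e_j`, with the bubble of `κ` extended by zero. -/
def Elt.bubbleField (Ω : Set (E d)) (κ : Elt d) (j : Fin d) : C(closure Ω, E d) where
  toFun x := EuclideanSpace.single j (κ.extBubble x)
  continuous_toFun :=
    (PiLp.continuous_toLp 2 _).comp ((continuous_single j).comp
      (κ.continuous_extBubble.comp continuous_subtype_val))

theorem Triangulation.ext_bubbleField (T : Triangulation Ω) {κ : Elt d} (hκ : κ ∈ T.elts)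
    (j : Fin d) : ext (κ.bubbleField Ω j) = fun x => EuclideanSpace.single j (κ.extBubble x) := by
  funext x
  by_cases hx : x ∈ closure Ω
  · rw [ext_apply_of_mem _ hx]
    rfl
  · rw [ext_apply_of_notMem _ hx, κ.extBubble_of_notMem fun h => hx (T.carrier_subset hκ h)]
    exact ((PiLp.single_eq_zero_iff 2 j).2 rfl).symm

theorem Triangulation.bubbleField_mem_X0h (T : Triangulation Ω) (hΩ : IsOpen Ω)
    (hΩr : interior (closure Ω) = Ω) {κ : Elt d} (hκ : κ ∈ T.elts) (j : Fin d) :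
    κ.bubbleField Ω j ∈ X0h T := by
  have := T.isFiniteMeasure
  refine ⟨fun κ' hκ' k => ?_, fun k => ?_⟩ <;> rw [T.ext_bubbleField hκ] <;>
    simp only [PiLp.single_apply] <;> split_ifs
  · exact T.isMiniOn_extBubble hκ hκ'
  · exact isP1On_zero.isMiniOn
  · exact T.memH10_extBubble hΩ hΩr hκ
  · exact memH10_zero hΩ

theorem Elt.setIntegral_mul_extBubble_pos (hΩ : IsOpen Ω) {κ : Elt d}
    (hκ : interior κ.carrier ⊆ Ω) {ε : E d → ℝ} (hε0 : ∀ x ∈ Ω, 0 < ε x)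
    (hint : IntegrableOn (fun x => ε x * κ.extBubble x) Ω) :
    0 < ∫ x in Ω, ε x * κ.extBubble x := by
  have hnonneg : 0 ≤ᵐ[volume.restrict Ω] fun x => ε x * κ.extBubble x :=
    ae_restrict_of_forall_mem hΩ.measurableSet fun x hx =>
      mul_nonneg (hε0 x hx).le (κ.extBubble_nonneg x)
  refine (setIntegral_pos_iff_support_of_nonneg_ae hnonneg hint).2 ?_
  refine (isOpen_interior.measure_pos volume κ.nonempty_interior).trans_le
    (measure_mono fun x hx => ⟨mul_ne_zero (hε0 x (hκ hx)).ne' ?_, hκ hx⟩)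
  rwa [← Function.mem_support, κ.support_extBubble]

theorem IsP1On.exists_eq_const_of_bForm_bubbleField (hΩ : IsOpen Ω)
    (hΩr : interior (closure Ω) = Ω) (T : Triangulation Ω) {ε : E d → ℝ} (hε : MemW1Top Ω ε)
    (hε0 : ∀ x ∈ Ω, 0 < ε x) {p : E d → ℝ} (hp : MemW1Top Ω p) {κ : Elt d} (hκ : κ ∈ T.elts)
    (hpκ : IsP1On κ.carrier p) (h : ∀ j, bForm Ω ε (ext (κ.bubbleField Ω j)) p = 0) :
    ∃ c, ∀ x ∈ κ.carrier, p x = c := by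
  have := T.isFiniteMeasure
  obtain ⟨a₀, a, ha⟩ := hpκ.exists_affine
  have hB0 := T.memH10_extBubble hΩ hΩr hκ
  have hpos := κ.setIntegral_mul_extBubble_pos hΩ (T.interior_subset hΩr hκ) hε0
    (integrable_mul_of_memLp_top (hε.memLp_top hΩ) (hB0.1.1.integrable one_le_two))
  have hslope : ∀ j, a j = 0 := by
    intro j
    have hint : ∫ x in Ω, ε x * weakPartial Ω j p x * κ.extBubble x
        = a j * ∫ x in Ω, ε x * κ.extBubble x := by
      rw [← integral_const_mul]
      refine integral_congr_ae ?_
      filter_upwards [hp.weakPartial_ae_eq hΩ j] with x hx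
      by_cases hxκ : x ∈ interior κ.carrier
      · have hpx : p =ᶠ[𝓝 x] fun y => a₀ + ∑ i, a i * y i :=
          Set.EqOn.eventuallyEq_of_mem ha (mem_interior_iff_mem_nhds.1 hxκ)
        rw [hx, classicalPartial, hpx.fderiv_eq, ← classicalPartial, classicalPartial_affine]
        ring
      · rw [← κ.support_extBubble, Function.notMem_support] at hxκ
        rw [hxκ]
        ring
    have hj := h j
    rw [T.ext_bubbleField hκ, bForm_single hΩ hε hB0 hp j, neg_eq_zero, hint] at hj
    exact (mul_eq_zero.1 hj).resolve_right hpos.ne'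
  exact ⟨a₀, fun x hx => by simp only [ha x hx, hslope, zero_mul, Finset.sum_const_zero, add_zero]⟩

theorem eq_zero_of_bForm_eq_zero (hΩ : IsOpen Ω) (hΩc : IsConnected Ω)
    (hΩr : interior (closure Ω) = Ω) (T : Triangulation Ω) {ε : E d → ℝ} (hε : MemW1Top Ω ε)
    (hε0 : ∀ x ∈ Ω, 0 < ε x) {p : C(closure Ω, ℝ)} (hp : p ∈ M0h T)
    (h : ∀ v ∈ X0h T, bForm Ω ε (ext v) (ext p) = 0) : p = 0 := by
  have hconst : ∀ κ ∈ T.elts, ∃ c, ∀ x ∈ κ.carrier, ext p x = c := fun κ hκ =>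
    (hp.1 κ hκ).exists_eq_const_of_bForm_bubbleField hΩ hΩr T hε hε0 (.of_mem_Mh hΩ hp.1) hκ
      fun j => h _ (T.bubbleField_mem_X0h hΩ hΩr hκ j)
  choose! c hc using hconst
  have hfinite : (ext p '' Ω).Finite := by
    refine (T.elts.finite_toSet.image c).subset ?_
    rintro _ ⟨x, hx, rfl⟩
    obtain ⟨κ, hκ, hxκ⟩ := T.exists_mem (subset_closure hx)
    exact ⟨κ, hκ, (hc κ hκ x hxκ).symm⟩
  have hsubsingleton : (ext p '' Ω).Subsingleton :=
    Set.not_nontrivial_iff.1 fun hnontrivial => (hΩc.isPreconnected.image _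
      ((continuousOn_ext p).mono subset_closure)).infinite_of_nontrivial hnontrivial hfinite
  obtain ⟨y, hy⟩ := hΩc.nonempty
  have hp_eq : ∀ x ∈ Ω, ext p x = ext p y := fun x hx => hsubsingleton ⟨x, hx, rfl⟩ ⟨y, hy, rfl⟩
  have hmean := hp.2.2
  rw [setIntegral_congr_fun hΩ.measurableSet hp_eq, setIntegral_const, smul_eq_mul] at hmean
  have hvol : volume.real Ω ≠ 0 :=
    (measureReal_ne_zero_iff (isFiniteMeasure_restrict.1 T.isFiniteMeasure)).2
      (hΩ.measure_pos volume hΩc.nonempty).ne'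
  have hp0 := (mul_eq_zero.1 hmean).resolve_left hvol
  exact eq_zero_of_eqOn_zero fun x hx => (hp_eq x hx).trans hp0

/-! ### The linear system -/

theorem existsUnique_saddle_point {K X M : Type*} [Field K] [AddCommGroup X] [Module K X]
    [FiniteDimensional K X] [AddCommGroup M] [Module K M] [FiniteDimensional K M]
    (A : X →ₗ[K] X →ₗ[K] K) (B : X →ₗ[K] M →ₗ[K] K)
    (hA : ∀ w, (∀ q, B w q = 0) → A w w = 0 → w = 0) (hB : ∀ p, (∀ v, B v p = 0) → p = 0)
    (F : X →ₗ[K] K) :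
    ∃! wp : X × M, (∀ v, A wp.1 v - B v wp.2 = F v) ∧ ∀ q, B wp.1 q = 0 := by
  let Φ : X × M →ₗ[K] Module.Dual K X × Module.Dual K M :=
    (A.coprod (-B.flip)).prod (B ∘ₗ LinearMap.fst K X M)
  have hΦ : ∀ wp F', Φ wp = (F', 0) ↔ (∀ v, A wp.1 v - B v wp.2 = F' v) ∧ ∀ q, B wp.1 q = 0 := by
    intro wp F'
    simp only [Φ, Prod.ext_iff, LinearMap.ext_iff, LinearMap.prod_apply, Function.prod,
      LinearMap.coprod_apply, LinearMap.add_apply, LinearMap.neg_apply, LinearMap.flip_apply,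
      LinearMap.comp_apply, LinearMap.fst_apply, LinearMap.zero_apply, sub_eq_add_neg]
  have hinj : Function.Injective Φ := by
    refine (injective_iff_map_eq_zero Φ).2 fun wp hwp => ?_
    obtain ⟨hmom, hdiv⟩ := (hΦ wp 0).1 hwp
    have hw : wp.1 = 0 := hA _ hdiv (by simpa [hdiv] using hmom wp.1)
    have hp : wp.2 = 0 := hB _ fun v => by simpa [hw] using hmom v
    exact Prod.ext hw hp
  have hsurj : Function.Surjective Φ :=
    (LinearMap.injective_iff_surjective_of_finrank_eq_finrank (by
      rw [Module.finrank_prod, Module.finrank_prod, Subspace.dual_finrank_eq,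
        Subspace.dual_finrank_eq])).1 hinj
  simpa only [hΦ] using Function.Bijective.existsUnique ⟨hinj, hsurj⟩ (F, 0)

theorem exists_linearMap_of_linear_comb {R X : Type*} [Semiring R] [AddCommMonoid X] [Module R X]
    {f : X → R} (h : ∀ (s t : R) v w, f (s • v + t • w) = s * f v + t * f w) :
    ∃ F : X →ₗ[R] R, ∀ v, F v = f v :=
  ⟨{ toFun := f
     map_add' := fun v w => by simpa using h 1 1 v w
     map_smul' := fun s v => by simpa using h s 0 v v }, fun _ => rfl⟩

theorem exists_linearMap₂_of_linear_comb {R X M : Type*} [CommSemiring R] [AddCommMonoid X]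
    [Module R X] [AddCommMonoid M] [Module R M] {f : X → M → R}
    (hl : ∀ (s t : R) v w q, f (s • v + t • w) q = s * f v q + t * f w q)
    (hr : ∀ (s t : R) v p q, f v (s • p + t • q) = s * f v p + t * f v q) :
    ∃ A : X →ₗ[R] M →ₗ[R] R, ∀ v q, A v q = f v q :=
  ⟨LinearMap.mk₂ R f (fun v w q => by simpa using hl 1 1 v w q)
    (fun s v q => by simpa using hl s 0 v v q) (fun v p q => by simpa using hr 1 1 v p q)
    (fun s v q => by simpa using hr s 0 v q q), fun _ _ => rfl⟩

theorem ext_coe_linear_comb {F : Type} [AddCommGroup F] [Module ℝ F] [TopologicalSpace F]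
    [IsTopologicalAddGroup F] [ContinuousConstSMul ℝ F] {S : Submodule ℝ C(closure Ω, F)}
    (s t : ℝ) (v w : S) : ext (s • v + t • w : S).1 = fun x => s • ext v.1 x + t • ext w.1 x :=
  ext_linear_comb s t v.1 w.1

section

variable {T : Triangulation Ω} {ε : E d → ℝ} {α β : ℝ → ℝ} {u : E d → E d}

theorem exists_momentumMap (hΩ : IsOpen Ω) (Re : ℝ) (hε : MemW1Top Ω ε)
    (hα : MemLp (fun x => α (ε x)) ⊤ (volume.restrict Ω))
    (hβ : MemLp (fun x => β (ε x)) ⊤ (volume.restrict Ω)) (hu : MemH1Vec Ω u) :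
    ∃ A : velocitySpace hΩ T →ₗ[ℝ] velocitySpace hΩ T →ₗ[ℝ] ℝ, ∀ v v',
      A v v' = aForm Ω Re α ε (ext v.1) (ext v'.1) + cForm Ω β ε u (ext v.1) (ext v'.1) := by
  have hH1 (v : velocitySpace hΩ T) : MemH1Vec Ω (ext v.1) := .of_mem_X0h v.2
  have hW1 (v : velocitySpace hΩ T) : MemW1TopVec Ω (ext v.1) := .of_mem_X0h hΩ v.2
  refine exists_linearMap₂_of_linear_comb (fun s t v v' w => ?_) (fun s t w v v' => ?_)
  · rw [ext_coe_linear_comb, aForm_linear_left hΩ Re hε hα (hH1 v) (hH1 v') (hH1 w),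
      cForm_linear_middle hΩ hε hβ hu (hH1 v) (hH1 v') (hW1 w)]
    ring
  · rw [ext_coe_linear_comb, aForm_linear_right hΩ Re hε hα (hH1 w) (hH1 v) (hH1 v'),
      cForm_linear_right hΩ hε hβ hu (hH1 w) (hW1 v) (hW1 v')]
    ring

theorem exists_divergenceMap (hΩ : IsOpen Ω) (hε : MemW1Top Ω ε) :
    ∃ B : velocitySpace hΩ T →ₗ[ℝ] pressureSpace T →ₗ[ℝ] ℝ, ∀ v q,
      B v q = bForm Ω ε (ext v.1) (ext q.1) := by
  refine exists_linearMap₂_of_linear_comb (fun s t v v' q => ?_) (fun s t v p q => ?_)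
  · rw [ext_coe_linear_comb,
      bForm_linear_left hΩ hε q.2.2.1 (.of_mem_X0h v.2) (.of_mem_X0h v'.2)]
  · rw [ext_coe_linear_comb]
    exact bForm_linear_right hΩ hε p.2.2.1 q.2.2.1 (.of_mem_X0h v.2) s t

theorem exists_loadMap (hΩ : IsOpen Ω) (Re : ℝ) (hε : MemW1Top Ω ε)
    (hα : MemLp (fun x => α (ε x)) ⊤ (volume.restrict Ω))
    (hβ : MemLp (fun x => β (ε x)) ⊤ (volume.restrict Ω)) {f G : E d → E d}
    (hf : MemLp f 2 (volume.restrict Ω)) (hu : MemH1Vec Ω u) (hG : MemH1Vec Ω G) :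
    ∃ F : velocitySpace hΩ T →ₗ[ℝ] ℝ, ∀ v,
      F v = lForm Ω ε f (ext v.1) - aForm Ω Re α ε G (ext v.1) - cForm Ω β ε u G (ext v.1) := by
  have hH1 (v : velocitySpace hΩ T) : MemH1Vec Ω (ext v.1) := .of_mem_X0h v.2
  refine exists_linearMap_of_linear_comb fun s t v v' => ?_
  rw [ext_coe_linear_comb, lForm_linear hΩ hε hf (hH1 v) (hH1 v'),
    aForm_linear_right hΩ Re hε hα hG (hH1 v) (hH1 v'),
    cForm_linear_right hΩ hε hβ hu hG (.of_mem_X0h hΩ v.2) (.of_mem_X0h hΩ v'.2)]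
  ring

end

theorem ext_mem_of_forall_mem {F : Type} [Zero F] {v : closure Ω → F} {s : Set F}
    (h : ∀ x : closure Ω, x.1 ∈ Ω → v x ∈ s) {x : E d} (hx : x ∈ Ω) : ext v x ∈ s := by
  rw [ext_apply_of_mem v (subset_closure hx)]
  exact h ⟨x, subset_closure hx⟩ hx

end DBF

end

theorem theorem3p2_general {d : ℕ} {Ω : Set (DBF.E d)} (hΩo : IsOpen Ω) (hΩc : IsConnected Ω)
    (hΩr : interior (closure Ω) = Ω) (T : DBF.Triangulation Ω) {Re : ℝ} (hRe : 0 < Re)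
    {α β : ℝ → ℝ} {εh : C(closure Ω, ℝ)} (hε : DBF.MemW1Top Ω (DBF.ext εh))
    (hε0 : ∀ x ∈ Ω, 0 < DBF.ext εh x)
    (hα : MeasureTheory.MemLp (fun x => α (DBF.ext εh x)) ⊤ (MeasureTheory.volume.restrict Ω))
    (hα0 : ∀ x ∈ Ω, 0 < α (DBF.ext εh x))
    (hβ : MeasureTheory.MemLp (fun x => β (DBF.ext εh x)) ⊤ (MeasureTheory.volume.restrict Ω))
    (hβ0 : ∀ x ∈ Ω, 0 ≤ β (DBF.ext εh x))
    {f : DBF.E d → DBF.E d} (hf : MeasureTheory.MemLp f 2 (MeasureTheory.volume.restrict Ω))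
    {G : DBF.E d → DBF.E d} (hG : DBF.MemH1Vec Ω G)
    {w : C(closure Ω, DBF.E d)} (hw : DBF.MemH1Vec Ω (DBF.ext w)) :
    ∃! wp : C(closure Ω, DBF.E d) × C(closure Ω, ℝ),
      wp.1 ∈ DBF.X0h T ∧ wp.2 ∈ DBF.M0h T ∧
        DBF.IsNextIterate T Re α β εh f G w wp.1 wp.2 := by
  have hu : DBF.MemH1Vec Ω (fun x => DBF.ext w x + G x) := by
    simpa using hw.linear_comb hΩo hG 1 1
  obtain ⟨A, hA⟩ := DBF.exists_momentumMap (T := T) hΩo Re hε hα hβ hu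
  obtain ⟨B, hB⟩ := DBF.exists_divergenceMap (T := T) hΩo hε
  obtain ⟨F, hF⟩ := DBF.exists_loadMap (T := T) hΩo Re hε hα hβ hf hu hG
  have henergy : ∀ v, (∀ q, B v q = 0) → A v v = 0 → v = 0 := fun v _ hv =>
    Subtype.ext <| DBF.eq_zero_of_energy_nonpos hΩo hRe.le hε (fun x hx => (hε0 x hx).le)
      hα hα0 hβ0 hu v.2 ((hA v v).symm.trans hv).le
  have hpressure : ∀ p, (∀ v, B v p = 0) → p = 0 := fun p hp =>
    Subtype.ext <| DBF.eq_zero_of_bForm_eq_zero hΩo hΩc hΩr T hε hε0 p.2 fun v hv =>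
      (hB ⟨v, hv⟩ p).symm.trans (hp ⟨v, hv⟩)
  obtain ⟨⟨w', p'⟩, hsol, huniq⟩ :=
    DBF.existsUnique_saddle_point (K := ℝ) (X := DBF.velocitySpace hΩo T)
      (M := DBF.pressureSpace T) A B henergy hpressure F
  simp only [hA, hB, hF, Subtype.forall] at hsol huniq
  refine ⟨(w'.1, p'.1), ⟨w'.2, p'.2, hsol⟩, ?_⟩
  rintro ⟨w₂, p₂⟩ ⟨hw₂, hp₂, hsol₂⟩
  have heq := huniq (⟨w₂, hw₂⟩, ⟨p₂, hp₂⟩) hsol₂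
  exact congrArg (fun wp => (wp.1.1, wp.2.1)) heq

theorem theorem3p2 {d : ℕ} (hd : d = 2 ∨ d = 3)
    (Ω : Set (DBF.E d)) (hΩo : IsOpen Ω) (hΩc : IsConnected Ω)
    (hΩr : interior (closure Ω) = Ω)
    (T : DBF.Triangulation Ω)
    (Re : ℝ) (hRe : 0 < Re)
    (ε₀ : ℝ) (hε₀ : 0 < ε₀)
    (α β : ℝ → ℝ) (hα : DBF.AdmissibleCoeff ε₀ α) (hβ : DBF.AdmissibleCoeff ε₀ β)
    (εh : C(closure Ω, ℝ)) (hεh : εh ∈ DBF.Mh T)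
    (hεh_bd : ∀ x : closure Ω, (x : DBF.E d) ∈ Ω → ε₀ ≤ εh x ∧ εh x ≤ 1)
    (f : DBF.E d → DBF.E d)
    (hf : MeasureTheory.MemLp f 2 (MeasureTheory.volume.restrict Ω))
    (G : DBF.E d → DBF.E d) (hG : DBF.MemH1Vec Ω G)
    (w : C(closure Ω, DBF.E d)) (hw : w ∈ DBF.X0h T) :
    ∃! wp : C(closure Ω, DBF.E d) × C(closure Ω, ℝ),
      wp.1 ∈ DBF.X0h T ∧ wp.2 ∈ DBF.M0h T ∧
        DBF.IsNextIterate T Re α β εh f G w wp.1 wp.2 := by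
  have hε := DBF.MemW1Top.of_mem_Mh hΩo hεh
  have hεI : ∀ x ∈ Ω, DBF.ext εh x ∈ Set.Icc ε₀ 1 := fun x hx =>
    DBF.ext_mem_of_forall_mem hεh_bd hx
  have hεm := (hε.memLp_top hΩo).aestronglyMeasurable.aemeasurable
  have hεae : ∀ᵐ x ∂MeasureTheory.volume.restrict Ω, DBF.ext εh x ∈ Set.Icc ε₀ 1 :=
    MeasureTheory.ae_restrict_of_forall_mem hΩo.measurableSet hεI
  exact theorem3p2_general hΩo hΩc hΩr T hRe hε (fun x hx => hε₀.trans_le (hεI x hx).1)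
    (hα.memLp_top hεm hεae) (fun x hx => hα.pos _ (hεI x hx))
    (hβ.memLp_top hεm hεae) (fun x hx => (hβ.pos _ (hεI x hx)).le) hf hG (.of_mem_X0h hw)
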